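/- **Setting.** A state $\theta\in[0,1]$ has prior $F$ with mean $\mu$; $F$ has a strictly positive density and a strictly log-concave cdf. A signal is a measurable map $\pi:[0,1]\to\Delta([0,1])$ from states to distributions of realizations $x$ such that $x=\mathbb{E}[\theta\mid x]$ almost surely; $G_\pi$ is the induced distribution of $x$. The sender covertly chooses a signal $\pi$ and a measurable disclosure rule $d$ which, at each $x$, randomizes between the message $x$ (certification, at cost $\gamma>0$) and the message $m_\varnothing$ (non-certification). The receiver observes only the message $m$ and takes an action $a\in[0,1]$. The sender's payoff is $a$, minus $\gamma$ if she certifies, minus the cost $\kappa\int c\,dG_\pi$, where $\kappa>0$ and $c$ is twice differentiable, strictly convex and bounded on $(0,1)$ with $c(\mu)=0$. A *covert equilibrium* consists of a signal $\pi$, a disclosure rule for every signal, and receiver actions and beliefs (posterior means in $[0,1]$) after every message such that: (1) the belief after a certified $x$ is $x$; the belief after $m_\varnothing$ is one number, not depending on the signal actually chosen, and it equals the conditional mean of $\theta$ given $m_\varnothing$ under the equilibrium strategy whenever $m_\varnothing$ has positive probability (otherwise it is arbitrary); (2) the action after every message equals the belief; (3) the sender's signal and disclosure strategy maximize her expected payoff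 over all signals and disclosure strategies, given the receiver's actions. Let $\mathcal M(F)$ be the set of mean-preserving contractions of $F$, that is, of the probability measures $G$ on $[0,1]$ with $\int_0^x G(s)\,ds\le\int_0^x F(s)\,ds$ for all $x\in[0,1]$ and equality at $x=1$ (writing $F$, $G$ also for the cdfs). For $\alpha\in[0,\mu]$ let $V_\alpha(x)=\alpha-\kappa c(x)$ if $x<\alpha+\gamma$ and $V_\alpha(x)=x-\gamma-\kappa c(x)$ if $x\ge\alpha+\gamma$. **Theorem.** For all such $F$, $c$, $\kappa$ and $\gamma$: 1. for every $\alpha\in[0,\mu]$ the problem $\max_{G\in\mathcal M(F)}\int V_\alpha\,dG$ has a unique solution $G_\alpha$, and the support of $G_\alpha$ has at most two points; 2. on the set of those $\alpha\in[0,\mu]$ for which the support of $G_\alpha$ has exactly two points, $\alpha\mapsto\min\operatorname{supp}G_\alpha$ is continuous; 3. a covert equilibrium exists. Equilibrium need not be unique: for some such $F,c,\kappa,\gamma$ there are two covert equilibria with different probabilities of certification on the path of play. -/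

import Mathlib

open MeasureTheory ProbabilityTheory Set

noncomputable section

/-- The cumulative distribution function `s ↦ G([0, s])` of a measure on `[0, 1]`. -/
def cdfOn (G : Measure unitInterval) (s : ℝ) : ℝ :=
  G.real {x : unitInterval | (x : ℝ) ≤ s}

/-- `G` is a mean-preserving contraction of `F`: it is a probability measure on `[0, 1]` whose
integrated cdf lies below that of `F` on `[0, 1]`, with equality at `1`. -/
def IsMPC (F G : Measure unitInterval) : Prop :=
  IsProbabilityMeasure G ∧
    (∀ x ∈ Icc (0 : ℝ) 1, ∫ s in (0 : ℝ)..x, cdfOn G s ≤ ∫ s in (0 : ℝ)..x, cdfOn F s) ∧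
    ∫ s in (0 : ℝ)..1, cdfOn G s = ∫ s in (0 : ℝ)..1, cdfOn F s

/-- The primitives of the disclosure game. -/
structure DisclosureModel where
  /-- the common prior on the state space `[0, 1]` -/
  F : Measure unitInterval
  /-- the cost of a posterior mean (only its values on `[0, 1]` matter) -/
  c : ℝ → ℝ
  /-- the scale of the cost of acquiring evidence -/
  κ : ℝ
  /-- the cost of certification -/
  γ : ℝ
  prob_F : IsProbabilityMeasure F
  density_F : ∃ f : unitInterval → ℝ, Measurable f ∧
    (∀ x : unitInterval, (x : ℝ) ∈ Ioo (0 : ℝ) 1 → 0 < f x) ∧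
    F = (volume : Measure unitInterval).withDensity (fun x => ENNReal.ofReal (f x))
  logConcave_F : StrictConcaveOn ℝ (Ioo (0 : ℝ) 1) (fun s => Real.log (cdfOn F s))
  differentiable_c : DifferentiableOn ℝ c (Ioo 0 1)
  differentiable_deriv_c : DifferentiableOn ℝ (deriv c) (Ioo 0 1)
  strictConvex_c : StrictConvexOn ℝ (Ioo 0 1) c
  bounded_c : ∃ B : ℝ, ∀ x ∈ Ioo (0 : ℝ) 1, |c x| ≤ B
  c_mean : c (∫ θ, (θ : ℝ) ∂F) = 0
  κ_pos : 0 < κ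
  γ_pos : 0 < γ

attribute [instance] DisclosureModel.prob_F

/-- Messages: `Sum.inl x` discloses the certified posterior mean `x`, and `Sum.inr ()` is
non-certification. -/
abbrev Message : Type := unitInterval ⊕ Unit

/-- The message sent when nothing is certified. -/
abbrev noCert : Message := Sum.inr ()

/-- A disclosure rule: a measurable map from posterior means to distributions of messages which,
at the posterior mean `x`, only uses the messages `x` and non-certification. -/
structure DisclosureRule where
  kernel : Kernel unitInterval Message
  markov : IsMarkovKernel kernel
  verifiable : ∀ x : unitInterval, kernel x {Sum.inl x, noCert} = 1

attribute [instance] DisclosureRule.markov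

namespace DisclosureModel

/-- The prior mean. -/
def mean (M : DisclosureModel) : ℝ := ∫ θ, (θ : ℝ) ∂M.F

/-- A signal: a measurable map from states to distributions of realizations in `[0, 1]`, each
realization being equal to the posterior mean of the state that it induces. -/
structure Signal (M : DisclosureModel) where
  kernel : Kernel unitInterval unitInterval
  markov : IsMarkovKernel kernel
  posteriorMean :
    (M.F ⊗ₘ kernel)[fun z : unitInterval × unitInterval => (z.1 : ℝ) |
        MeasurableSpace.comap Prod.snd inferInstance]
      =ᵐ[M.F ⊗ₘ kernel] fun z => (z.2 : ℝ)

attribute [instance] Signal.markov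

/-- The distribution of posterior means that a signal induces. -/
def Signal.posteriorLaw {M : DisclosureModel} (π : M.Signal) : Measure unitInterval :=
  π.kernel ∘ₘ M.F

/-- The joint law of the state and the message. -/
def outcome (M : DisclosureModel) (π : M.Signal) (δ : DisclosureRule) :
    Measure (unitInterval × Message) :=
  M.F ⊗ₘ (δ.kernel ∘ₖ π.kernel)

/-- The event that the sender does not certify. -/
def noCertEvent : Set (unitInterval × Message) := Prod.snd ⁻¹' {noCert}

/-- The cost of acquiring a distribution of posterior means. -/
def infoCost (M : DisclosureModel) (G : Measure unitInterval) : ℝ :=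
  M.κ * ∫ x, M.c x ∂G

/-- The sender's expected payoff from the signal `π` and the disclosure rule `δ`, when the receiver
answers each message `m` with the action `a m`. -/
def senderPayoff (M : DisclosureModel) (a : Message → unitInterval) (π : M.Signal)
    (δ : DisclosureRule) : ℝ :=
  (∫ x, ((δ.kernel x).real {Sum.inl x} * ((a (Sum.inl x) : ℝ) - M.γ)
      + (δ.kernel x).real {noCert} * (a noCert : ℝ)) ∂π.posteriorLaw)
    - M.infoCost π.posteriorLaw

/-- An assessment: the sender's signal and disclosure strategy, the receiver's strategy, and the
receiver's beliefs, summarized by the posterior mean of the state. -/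
structure Assessment (M : DisclosureModel) where
  signal : M.Signal
  disclose : M.Signal → DisclosureRule
  action : Message → M.Signal → unitInterval
  belief : Message → M.Signal → unitInterval

/-- The joint law of the state and the message on the path of play. -/
def Assessment.path {M : DisclosureModel} (σ : M.Assessment) : Measure (unitInterval × Message) :=
  M.outcome σ.signal (σ.disclose σ.signal)

/-- Covert equilibrium. The receiver does not observe the signal that is chosen, so the belief after
non-certification is one number, whatever signal was actually chosen; it is the conditional mean of
the state under the equilibrium strategy whenever non-certification has positive probability, and
it is unrestricted otherwise. -/
structure IsCovertEquilibrium {M : DisclosureModel} (σ : M.Assessment) : Prop where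
  belief_cert : ∀ (π' : M.Signal) (x : unitInterval), σ.belief (Sum.inl x) π' = x
  belief_noCert : ∃ e : unitInterval, (∀ π' : M.Signal, σ.belief noCert π' = e) ∧
    (σ.path noCertEvent ≠ 0 → (e : ℝ) = ∫ z, (z.1 : ℝ) ∂(cond σ.path noCertEvent))
  action_eq : ∀ (m : Message) (π' : M.Signal), σ.action m π' = σ.belief m π'
  optimal : ∀ (π' : M.Signal) (d' : M.Signal → DisclosureRule),
    M.senderPayoff (fun m => σ.action m π') π' (d' π')
      ≤ M.senderPayoff (fun m => σ.action m σ.signal) σ.signal (σ.disclose σ.signal)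

/-- The sender's payoff from the posterior mean `x` when non-certification is answered with `α`. -/
def V (M : DisclosureModel) (α : ℝ) (x : ℝ) : ℝ :=
  if x < α + M.γ then α - M.κ * M.c x else x - M.γ - M.κ * M.c x

/-- `G` maximizes `∫ V_α dG` over the mean-preserving contractions `G` of the prior. -/
def IsSolution (M : DisclosureModel) (α : ℝ) (G : Measure unitInterval) : Prop :=
  IsMPC M.F G ∧ ∀ G', IsMPC M.F G' → ∫ x, M.V α x ∂G' ≤ ∫ x, M.V α x ∂G

end DisclosureModel

/-- The lowest point of the support of a probability measure on `[0, 1]`. -/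
def lowerSupport (G : Measure unitInterval) : ℝ :=
  sInf ((fun x : unitInterval => (x : ℝ)) '' G.support)

end

noncomputable section

/-! ### Integrated cdfs as expected values of `max (x - y) 0` -/

section IntegratedCdf

/-! Since `V_α(x) = max(α, x - γ) - κ c(x)`, the payoff is an affine function minus a strictly
convex one on each side of the threshold `α + γ`. By Jensen, pooling the realizations on each side
into their conditional mean keeps `G` a contraction of the prior and raises `∫ V_α dG`, strictly
unless `G` already sits on these two means (`exists_coarsening`). The problem thus reduces to
triples (low point, high point, weight). These form a compact set on which the objective is
continuous, so a solution with at most two support points exists. If there are two solutions, their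
average is also a solution, hence lives on one point per side; so both solutions use the same two
points, and the mean fixes the weights (`IsSolution.eq`).

The set of pairs (`α`, optimal triple) is closed and the triples range over a compact space, so the
low point is continuous in `α` wherever it is determined (`continuousOn_of_optimal`).

Signals induce contractions of the prior, and every binary contraction comes from a signal.
Certifying from `e + γ` on is a best reply to `e`. An equilibrium is therefore an `e` for which the
optimum has low point `e`, or for which the optimum puts no mass below the threshold, so that the
belief `e` is off path. If the second case never occurs, the low point `a(α)` is continuous on `[0,
μ]` with `a(0) ≥ 0` and `a(μ) ≤ μ`, and the intermediate value theorem gives `a(α) = α`.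

Multiplicity comes from a uniform prior and quadratic cost with `γ = 1/4`, where the common tangent
of the two branches of `V_α` touches the lower branch exactly at `α`. -/

theorem Continuous.integrable_unitInterval {f : unitInterval → ℝ} (hf : Continuous f)
    (G : Measure unitInterval) [IsFiniteMeasure G] : Integrable f G :=
  hf.integrable_of_hasCompactSupport (HasCompactSupport.of_compactSpace f)

theorem volume_real_Ioc_inter_Ici {x y : ℝ} (hy : 0 ≤ y) :
    volume.real (Ioc 0 x ∩ Ici y) = max (x - y) 0 := by
  have h : volume (Ioc 0 x ∩ Ici y) = ENNReal.ofReal (x - y) := by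
    apply le_antisymm
    · rw [← Real.volume_Icc]
      exact measure_mono fun s hs => ⟨hs.2, hs.1.2⟩
    · rw [← Real.volume_Ioc]
      exact measure_mono fun s hs => ⟨⟨hy.trans_lt hs.1, hs.2⟩, hs.1.le⟩
  rw [Measure.real, h, ENNReal.toReal_ofReal']

/-- Fubini: `max (x - y) 0` is the length of the set of `s` in `(0, x]` with `y ≤ s`. -/
theorem integral_cdfOn (G : Measure unitInterval) [IsFiniteMeasure G] {x : ℝ} (hx : 0 ≤ x) :
    ∫ s in (0 : ℝ)..x, cdfOn G s = ∫ y : unitInterval, max (x - y) 0 ∂G := by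
  have hm : MeasurableSet {z : ℝ × unitInterval | (z.2 : ℝ) ≤ z.1} :=
    measurableSet_le (by fun_prop) (by fun_prop)
  have hcdf : ∀ s, cdfOn G s
      = ∫ y : unitInterval, {z : ℝ × unitInterval | (z.2 : ℝ) ≤ z.1}.indicator 1 (s, y) ∂G := by
    intro s
    have : (fun y : unitInterval =>
        {z : ℝ × unitInterval | (z.2 : ℝ) ≤ z.1}.indicator (1 : ℝ × unitInterval → ℝ) (s, y))
        = {y : unitInterval | (y : ℝ) ≤ s}.indicator 1 := by
      ext y; simp [indicator]
    rw [this, integral_indicator_one (measurableSet_le (by fun_prop) (by fun_prop)), cdfOn]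
  simp_rw [intervalIntegral.integral_of_le hx, hcdf]
  rw [integral_integral_swap]
  · refine integral_congr_ae (ae_of_all _ fun y => ?_)
    have : (fun s : ℝ =>
        {z : ℝ × unitInterval | (z.2 : ℝ) ≤ z.1}.indicator (1 : ℝ × unitInterval → ℝ) (s, y))
        = (Ici (y : ℝ)).indicator 1 := by
      ext s; simp [indicator]
    simp only [this]
    rw [integral_indicator_one measurableSet_Ici, measureReal_restrict_apply measurableSet_Ici,
      inter_comm, volume_real_Ioc_inter_Ici y.2.1]
  · refine Integrable.of_bound (C := 1) ?_ (ae_of_all _ fun z => ?_)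
    · exact (measurable_one.indicator hm).aestronglyMeasurable
    · simp only [Function.uncurry, indicator]
      split_ifs <;> simp

theorem integral_max_one_sub (G : Measure unitInterval) [IsProbabilityMeasure G] :
    ∫ y : unitInterval, max (1 - (y : ℝ)) 0 ∂G = 1 - ∫ y : unitInterval, (y : ℝ) ∂G := by
  have : ∀ y : unitInterval, max (1 - (y : ℝ)) 0 = 1 - y := fun y => max_eq_left (by linarith [y.2.2])
  simp_rw [this]
  rw [integral_sub (integrable_const _) (continuous_subtype_val.integrable_unitInterval G)]
  simp

/-- In this form every condition is an integral against `G` of a continuous function, hence stable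
under mixtures and accessible to Jensen's inequality. -/
theorem isMPC_iff {F G : Measure unitInterval} [IsProbabilityMeasure F] :
    IsMPC F G ↔ IsProbabilityMeasure G ∧
      (∀ x ∈ Icc (0 : ℝ) 1, ∫ y : unitInterval, max (x - y) 0 ∂G
        ≤ ∫ y : unitInterval, max (x - y) 0 ∂F) ∧
      ∫ y : unitInterval, (y : ℝ) ∂G = ∫ y : unitInterval, (y : ℝ) ∂F := by
  unfold IsMPC
  refine and_congr_right fun hG => and_congr (forall₂_congr fun x hx => ?_) ?_
  · rw [integral_cdfOn G hx.1, integral_cdfOn F hx.1]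
  · rw [integral_cdfOn G zero_le_one, integral_cdfOn F zero_le_one, integral_max_one_sub,
      integral_max_one_sub]
    constructor <;> intro h <;> linarith

theorem integral_max_sub (G : Measure unitInterval) [IsProbabilityMeasure G] (x : ℝ) :
    ∫ y : unitInterval, max (y - x) 0 ∂G
      = ∫ y : unitInterval, max (x - y) 0 ∂G + ∫ y : unitInterval, (y : ℝ) ∂G - x := by
  have : ∀ y : unitInterval, max ((y : ℝ) - x) 0 = max (x - y) 0 + (y - x) := fun y => by
    rcases le_total x y with h | h
    · rw [max_eq_left (by linarith), max_eq_right (by linarith)]; ring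
    · rw [max_eq_right (by linarith), max_eq_left (by linarith)]; ring
  simp_rw [this]
  have h1 : Integrable (fun y : unitInterval => max (x - (y : ℝ)) 0) G :=
    Continuous.integrable_unitInterval (by fun_prop) G
  have h2 := continuous_subtype_val.integrable_unitInterval G
  rw [integral_add (g := fun y : unitInterval => (y : ℝ) - x) h1 (h2.sub (integrable_const _)),
    integral_sub h2 (integrable_const _)]
  simp
  ring

theorem tendsto_measureReal_le_zero (F : Measure unitInterval) [IsFiniteMeasure F]
    (g : unitInterval → ℝ) (hg : Measurable g) (h0 : F {y | g y ≤ 0} = 0) :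
    Filter.Tendsto (fun n : ℕ => F.real {y : unitInterval | g y ≤ 1 / ((n : ℝ) + 1)})
      Filter.atTop (nhds 0) := by
  have h : Filter.Tendsto (fun n : ℕ => F {y : unitInterval | g y ≤ 1 / ((n : ℝ) + 1)})
      Filter.atTop (nhds (F (⋂ n : ℕ, {y : unitInterval | g y ≤ 1 / ((n : ℝ) + 1)}))) := by
    refine tendsto_measure_iInter_atTop
      (fun n => (measurableSet_le hg measurable_const).nullMeasurableSet) ?_
      ⟨0, measure_ne_top _ _⟩
    intro m n hmn y hy
    exact (show g y ≤ _ from hy).trans (Nat.one_div_le_one_div hmn)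
  have h1 : (⋂ n : ℕ, {y : unitInterval | g y ≤ 1 / ((n : ℝ) + 1)}) = {y | g y ≤ 0} := by
    ext y
    simp only [mem_iInter, mem_ofPred_eq]
    refine ⟨fun hy => ?_, fun hy n => hy.trans (by positivity)⟩
    exact ge_of_tendsto tendsto_one_div_add_atTop_nhds_zero_nat (Filter.Eventually.of_forall hy)
  rw [h1, h0] at h
  exact (ENNReal.tendsto_toReal ENNReal.zero_ne_top).comp h

/-- If the call prices of `G` on `g` near zero are below those of `F`, and `F` gives no mass to the
zeros of `g`, then neither does `G`. -/
theorem measure_zeros_eq_zero (F G : Measure unitInterval) [IsProbabilityMeasure F]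
    [IsProbabilityMeasure G] (g : unitInterval → ℝ) (hg : Continuous g) (hg0 : ∀ y, 0 ≤ g y)
    (h0 : F {y | g y ≤ 0} = 0)
    (hle : ∀ x ∈ Icc (0 : ℝ) 1, ∫ y, max (x - g y) 0 ∂G ≤ ∫ y, max (x - g y) 0 ∂F) :
    G {y | g y ≤ 0} = 0 := by
  have key : ∀ n : ℕ, G.real {y | g y ≤ 0} ≤ F.real {y : unitInterval | g y ≤ 1 / ((n : ℝ) + 1)} := by
    intro n
    -- A Markov-type sandwich: `x * G(g ≤ 0) ≤ ∫ max (x - g) 0 ∂G ≤ ∫ max (x - g) 0 ∂F ≤ x * F(g ≤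
    -- x)`. Divide by `x` and let `x` tend to zero.
    set x : ℝ := 1 / ((n : ℝ) + 1) with hx
    have hx0 : 0 < x := by positivity
    have hx1 : x ≤ 1 := by
      rw [hx, div_le_one (by positivity)]; linarith [(Nat.cast_nonneg n : (0 : ℝ) ≤ n)]
    have hint : ∀ (H : Measure unitInterval) [IsProbabilityMeasure H],
        Integrable (fun y => max (x - g y) 0) H := fun H _ =>
      Continuous.integrable_unitInterval (by fun_prop) H
    have m0 : MeasurableSet {y | g y ≤ 0} := measurableSet_le hg.measurable measurable_const
    have mx : MeasurableSet {y | g y ≤ x} := measurableSet_le hg.measurable measurable_const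
    have h1 : x * G.real {y | g y ≤ 0} ≤ ∫ y, max (x - g y) 0 ∂G := by
      have : ∫ y, {y | g y ≤ 0}.indicator (fun _ => x) y ∂G = x * G.real {y | g y ≤ 0} := by
        rw [integral_indicator_const _ m0, smul_eq_mul, mul_comm]
      rw [← this]
      refine integral_mono ((integrable_const x).indicator m0) (hint G) fun y => ?_
      simp only [indicator, mem_ofPred_eq]
      split_ifs with h
      · exact le_max_of_le_left (by linarith)
      · exact le_max_right _ _
    have h2 : ∫ y, max (x - g y) 0 ∂F ≤ x * F.real {y | g y ≤ x} := by
      have : ∫ y, {y | g y ≤ x}.indicator (fun _ => x) y ∂F = x * F.real {y | g y ≤ x} := by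
        rw [integral_indicator_const _ mx, smul_eq_mul, mul_comm]
      rw [← this]
      refine integral_mono (hint F) ((integrable_const x).indicator mx) fun y => ?_
      simp only [indicator, mem_ofPred_eq]
      split_ifs with h
      · exact max_le (by linarith [hg0 y]) hx0.le
      · exact max_le (by linarith) le_rfl
    exact le_of_mul_le_mul_left (h1.trans ((hle x ⟨hx0.le, hx1⟩).trans h2)) hx0
  have h := ge_of_tendsto (tendsto_measureReal_le_zero F g hg.measurable h0)
    (Filter.Eventually.of_forall key)
  exact (measureReal_eq_zero_iff (measure_ne_top _ _)).1 (le_antisymm h measureReal_nonneg)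

/-- The cost `c` is controlled only on the open interval and may jump at the endpoints; this lemma
makes those values irrelevant. The endpoint 1 is reduced to the case of 0 by the reflection `y ↦ 1 -
y`, the equality of means turning one-sided integrals on the left into those on the right. -/
theorem IsMPC.ae_mem_Ioo {F G : Measure unitInterval} [IsProbabilityMeasure F]
    [NullSingletonClass F] (h : IsMPC F G) : ∀ᵐ y : unitInterval ∂G, (y : ℝ) ∈ Ioo (0 : ℝ) 1 := by
  obtain ⟨hG, hle, hmean⟩ := isMPC_iff.1 h
  have h0 : G {y : unitInterval | (y : ℝ) ≤ 0} = 0 := by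
    refine measure_zeros_eq_zero F G (fun y => (y : ℝ)) (by fun_prop) (fun y => y.2.1) ?_ hle
    have : {y : unitInterval | (y : ℝ) ≤ 0} ⊆ {0} := fun y hy => Subtype.ext (le_antisymm hy y.2.1)
    exact measure_mono_null this (measure_singleton _)
  have h1 : G {y : unitInterval | (1 - (y : ℝ)) ≤ 0} = 0 := by
    refine measure_zeros_eq_zero F G (fun y => 1 - (y : ℝ)) (by fun_prop)
      (fun y => by linarith [y.2.2]) ?_ fun x hx => ?_
    · have : {y : unitInterval | 1 - (y : ℝ) ≤ 0} ⊆ {1} :=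
        fun y hy => Subtype.ext (le_antisymm y.2.2 (by simpa using hy))
      exact measure_mono_null this (measure_singleton _)
    · have e : ∀ y : unitInterval, x - (1 - (y : ℝ)) = y - (1 - x) := fun y => by ring
      simp_rw [e]
      rw [integral_max_sub, integral_max_sub, hmean]
      linarith [hle (1 - x) ⟨by linarith [hx.2], by linarith [hx.1]⟩]
  rw [ae_iff]
  refine measure_mono_null (fun y hy => ?_) (measure_union_null h0 h1)
  simp only [mem_ofPred_eq, mem_Ioo, not_and_or, not_lt] at hy
  rcases hy with hy | hy
  · exact Or.inl hy
  · exact Or.inr (by simpa using hy)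

end IntegratedCdf

/-! ### Two-point distributions -/

section Binary

/-- The distribution that puts mass `p` on `a` and the remaining mass on `b`. -/
def binary (a b p : unitInterval) : Measure unitInterval :=
  ENNReal.ofReal p • Measure.dirac a + ENNReal.ofReal (1 - p) • Measure.dirac b

instance (a b p : unitInterval) : IsProbabilityMeasure (binary a b p) where
  measure_univ := by
    simp only [binary, Measure.coe_add, Measure.coe_smul, Pi.add_apply, Pi.smul_apply,
      measure_univ, smul_eq_mul, mul_one]
    rw [← ENNReal.ofReal_add p.2.1 (by linarith [p.2.2])]
    simp

theorem binary_apply (a b p : unitInterval) (s : Set unitInterval) :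
    binary a b p s = ENNReal.ofReal p * s.indicator 1 a + ENNReal.ofReal (1 - p) * s.indicator 1 b := by
  simp [binary]

theorem integral_binary (a b p : unitInterval) (f : unitInterval → ℝ) :
    ∫ y, f y ∂binary a b p = p * f a + (1 - p) * f b := by
  rw [binary, integral_add_measure ((integrable_dirac (by simp)).smul_measure ENNReal.ofReal_ne_top)
    ((integrable_dirac (by simp)).smul_measure ENNReal.ofReal_ne_top), integral_smul_measure,
    integral_smul_measure, integral_dirac, integral_dirac, ENNReal.toReal_ofReal p.2.1,
    ENNReal.toReal_ofReal (by linarith [p.2.2])]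
  simp

theorem ae_binary_iff {a b p : unitInterval} {P : unitInterval → Prop} :
    (∀ᵐ y ∂binary a b p, P y) ↔ ((0 : ℝ) < p → P a) ∧ ((p : ℝ) < 1 → P b) := by
  rw [ae_iff, binary_apply]
  have h0 : (p : ℝ) ≤ 0 ↔ p = 0 := ⟨fun h => Subtype.ext (le_antisymm h p.2.1), fun h => by simp [h]⟩
  have h1 : (1 : ℝ) ≤ p ↔ 1 ≤ p := Iff.rfl
  by_cases ha : P a <;> by_cases hb : P b <;> simp [ha, hb, h0, h1]

theorem isMPC_binary_iff {F : Measure unitInterval} [IsProbabilityMeasure F] {a b p : unitInterval} :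
    IsMPC F (binary a b p) ↔
      (∀ x ∈ Icc (0 : ℝ) 1, (p : ℝ) * max (x - a) 0 + (1 - p) * max (x - b) 0
        ≤ ∫ y : unitInterval, max (x - y) 0 ∂F) ∧
      (p : ℝ) * a + (1 - p) * b = ∫ y : unitInterval, (y : ℝ) ∂F := by
  rw [isMPC_iff]
  simp only [integral_binary]
  exact ⟨fun h => h.2, fun h => ⟨inferInstance, h⟩⟩

/-- A measure that is concentrated on one point on each side of a partition is binary. -/
theorem eq_binary {G : Measure unitInterval} [IsProbabilityMeasure G] {S : Set unitInterval}
    (hS : MeasurableSet S) {a b p : unitInterval} (hp : G.real S = p)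
    (ha : ∀ᵐ y ∂G, y ∈ S → y = a) (hb : ∀ᵐ y ∂G, y ∉ S → y = b) : G = binary a b p := by
  have hpS : G S = ENNReal.ofReal p := by rw [← hp, ofReal_measureReal]
  have hpSc : G Sᶜ = ENNReal.ofReal (1 - p) := by
    rw [← hp, ← probReal_compl_eq_one_sub hS, ofReal_measureReal]
  ext s hs
  rw [binary_apply, ← measure_inter_add_sdiff s hS, ← hpS, ← hpSc]
  congr 1
  · by_cases h : a ∈ s
    · simp only [indicator_of_mem h, Pi.one_apply, mul_one]
      refine measure_congr ?_
      filter_upwards [ha] with y hy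
      exact propext ⟨fun h' => h'.2, fun h' => ⟨(hy h') ▸ h, h'⟩⟩
    · simp only [indicator_of_notMem h, mul_zero]
      rw [measure_eq_zero_iff_ae_notMem]
      filter_upwards [ha] with y hy h'
      exact h (hy h'.2 ▸ h'.1)
  · by_cases h : b ∈ s
    · simp only [indicator_of_mem h, Pi.one_apply, mul_one]
      refine measure_congr ?_
      filter_upwards [hb] with y hy
      exact propext ⟨fun h' => h'.2, fun h' => ⟨(hy h') ▸ h, h'⟩⟩
    · simp only [indicator_of_notMem h, mul_zero]
      rw [measure_eq_zero_iff_ae_notMem]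
      filter_upwards [hb] with y hy h'
      exact h (hy h'.2 ▸ h'.1)

theorem support_binary_subset (a b p : unitInterval) : (binary a b p).support ⊆ {a, b} := by
  refine Measure.support_subset_of_isClosed (Set.Finite.isClosed (by simp)) ?_
  rw [← Filter.eventually_mem_set, ae_binary_iff]
  simp

end Binary

/-! ### Conditional means and Jensen's inequality -/

section ConditionalMean

variable (G : Measure unitInterval) [IsProbabilityMeasure G] {S : Set unitInterval}

/-- The product form makes sense on null sets too, where the mean defaults to `d`; any bounds that
`d` satisfies then still hold. -/
theorem exists_condMean (hS : MeasurableSet S) (d : unitInterval) :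
    ∃ a : unitInterval, ∫ y in S, (y : ℝ) ∂G = G.real S * a ∧
      ∀ l u : ℝ, (∀ y ∈ S, l ≤ (y : ℝ) ∧ (y : ℝ) ≤ u) → l ≤ d → (d : ℝ) ≤ u → l ≤ a ∧ (a : ℝ) ≤ u := by
  have hint : IntegrableOn (fun y : unitInterval => (y : ℝ)) S G :=
    (continuous_subtype_val.integrable_unitInterval G).integrableOn
  by_cases h0 : G.real S = 0
  · refine ⟨d, ?_, fun l u _ h1 h2 => ⟨h1, h2⟩⟩
    rw [h0, zero_mul, setIntegral_measure_zero]
    exact (measureReal_eq_zero_iff (measure_ne_top _ _)).1 h0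
  · have hpos : 0 < G.real S := lt_of_le_of_ne measureReal_nonneg (Ne.symm h0)
    have hb : ∀ l u : ℝ, (∀ y ∈ S, l ≤ (y : ℝ) ∧ (y : ℝ) ≤ u) →
        l ≤ (∫ y in S, (y : ℝ) ∂G) / G.real S ∧ (∫ y in S, (y : ℝ) ∂G) / G.real S ≤ u := by
      intro l u h
      rw [le_div_iff₀ hpos, div_le_iff₀ hpos]
      have hc : ∀ r : ℝ, r * G.real S = ∫ _ in S, r ∂G := fun r => by
        rw [setIntegral_const, smul_eq_mul, mul_comm]
      constructor
      · rw [hc]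
        exact setIntegral_mono_on (integrable_const _).integrableOn hint hS fun y hy => (h y hy).1
      · rw [hc]
        exact setIntegral_mono_on hint (integrable_const _).integrableOn hS fun y hy => (h y hy).2
    refine ⟨⟨_, hb 0 1 fun y _ => y.2⟩, ?_, fun l u h _ _ => hb l u h⟩
    simp only
    field_simp

variable {G}

theorem setIntegral_sub_condMean {a : unitInterval}
    (ha : ∫ y in S, (y : ℝ) ∂G = G.real S * a) (m r : ℝ) :
    ∫ y in S, (m + r * (y : ℝ)) ∂G = G.real S * (m + r * a) := by
  have hint : IntegrableOn (fun y : unitInterval => r * (y : ℝ)) S G :=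
    (Continuous.integrable_unitInterval (by fun_prop) G).integrableOn
  rw [integral_add (integrable_const _).integrableOn hint, setIntegral_const, smul_eq_mul,
    integral_const_mul, ha]
  ring

theorem condMean_mul_max_le {a : unitInterval} (hS : MeasurableSet S)
    (ha : ∫ y in S, (y : ℝ) ∂G = G.real S * a) (x : ℝ) :
    G.real S * max (x - a) 0 ≤ ∫ y in S, max (x - (y : ℝ)) 0 ∂G := by
  rw [mul_max_of_nonneg _ _ measureReal_nonneg, mul_zero]
  refine max_le ?_ (setIntegral_nonneg hS fun y _ => le_max_right _ _)
  have h := setIntegral_sub_condMean ha x (-1)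
  rw [show x + -1 * (a : ℝ) = x - a by ring] at h
  rw [← h]
  refine setIntegral_mono_on ?_ ?_ hS fun y _ => ?_
  · exact (Continuous.integrable_unitInterval (by fun_prop) G).integrableOn
  · exact (Continuous.integrable_unitInterval (by fun_prop) G).integrableOn
  · exact le_max_of_le_left (by linarith)

end ConditionalMean

theorem StrictConvexOn.tangent_lt {s : Set ℝ} {f : ℝ → ℝ} (hf : StrictConvexOn ℝ s f) {x m : ℝ}
    (hx : x ∈ s) (hm : m ∈ s) (hd : DifferentiableAt ℝ f m) (hne : x ≠ m) :
    f m + deriv f m * (x - m) < f x := by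
  rcases lt_or_gt_of_ne hne with h | h
  · have := hf.slope_lt_deriv hx hm h hd
    rw [slope_def_field, div_lt_iff₀ (by linarith)] at this
    linarith
  · have := hf.lt_slope_of_hasDerivAt hm hx h hd.hasDerivAt
    rw [slope_def_field, lt_div_iff₀ (by linarith)] at this
    linarith

/-! ### Pooling on each side of the certification threshold -/

namespace DisclosureModel

variable (M : DisclosureModel)

instance : NullSingletonClass M.F := by
  obtain ⟨f, -, -, h⟩ := M.density_F
  rw [h]
  infer_instance

theorem measurable_c : Measurable fun y : unitInterval => M.c y := by
  have hs : MeasurableSet {y : unitInterval | (y : ℝ) ∈ Ioo (0 : ℝ) 1} :=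
    measurable_subtype_coe measurableSet_Ioo
  have hc : {y : unitInterval | (y : ℝ) ∈ Ioo (0 : ℝ) 1}ᶜ.Finite := by
    refine Set.Finite.subset (Set.toFinite ({0, 1} : Set unitInterval)) fun y hy => ?_
    simp only [mem_compl_iff, mem_ofPred_eq, mem_Ioo, not_and_or, not_lt] at hy
    rcases hy with hy | hy
    · exact Or.inl (Subtype.ext (le_antisymm hy y.2.1))
    · exact Or.inr (Subtype.ext (le_antisymm y.2.2 hy))
  classical
  have h := ContinuousOn.measurable_piecewise
    (f := fun y : unitInterval => M.c y) (g := fun y : unitInterval => M.c y)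
    (s := {y : unitInterval | (y : ℝ) ∈ Ioo (0 : ℝ) 1})
    (M.differentiable_c.continuousOn.comp continuous_subtype_val.continuousOn fun y hy => hy)
    (hc.continuousOn _) hs
  simpa using h

theorem exists_bound_c : ∃ B : ℝ, 0 ≤ B ∧ ∀ y : unitInterval, |M.c y| ≤ B := by
  obtain ⟨B, hB⟩ := M.bounded_c
  refine ⟨max B (max |M.c 0| |M.c 1|), ?_, fun y => ?_⟩
  · exact le_max_of_le_right (le_max_of_le_left (abs_nonneg _))
  · rcases y.2.1.eq_or_lt with h | h
    · rw [← h]; exact le_max_of_le_right (le_max_left _ _)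
    rcases y.2.2.eq_or_lt with h' | h'
    · rw [h']; exact le_max_of_le_right (le_max_right _ _)
    exact le_max_of_le_left (hB _ ⟨h, h'⟩)

theorem integrable_c (G : Measure unitInterval) [IsFiniteMeasure G] :
    Integrable (fun y : unitInterval => M.c y) G := by
  obtain ⟨B, -, hB⟩ := M.exists_bound_c
  exact Integrable.of_bound M.measurable_c.aestronglyMeasurable B (ae_of_all _ hB)

theorem V_eq (α x : ℝ) : M.V α x = max α (x - M.γ) - M.κ * M.c x := by
  unfold V
  split_ifs with h
  · rw [max_eq_left (by linarith)]
  · rw [max_eq_right (by linarith)]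

theorem integrable_max (α : ℝ) (G : Measure unitInterval) [IsFiniteMeasure G] :
    Integrable (fun y : unitInterval => max α ((y : ℝ) - M.γ)) G :=
  Continuous.integrable_unitInterval (by fun_prop) G

theorem integrable_V (α : ℝ) (G : Measure unitInterval) [IsFiniteMeasure G] :
    Integrable (fun y : unitInterval => M.V α y) G := by
  simp_rw [V_eq]
  exact (M.integrable_max α G).sub ((M.integrable_c G).const_mul _)

theorem differentiableAt_c {x : ℝ} (hx : x ∈ Ioo (0 : ℝ) 1) : DifferentiableAt ℝ M.c x :=
  (M.differentiable_c x hx).differentiableAt (Ioo_mem_nhds hx.1 hx.2)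

/-- Jensen's inequality with its equality case. The gap between `c` and its tangent at the
conditional mean is positive away from that mean, so if it integrates to zero over `S` then almost
all of `S` sits at the mean. -/
theorem condMean_mul_c_le {G : Measure unitInterval} [IsProbabilityMeasure G]
    (hI : ∀ᵐ y : unitInterval ∂G, (y : ℝ) ∈ Ioo (0 : ℝ) 1) {S : Set unitInterval}
    (hS : MeasurableSet S) {a : unitInterval} (ha : ∫ y in S, (y : ℝ) ∂G = G.real S * a)
    (haI : 0 < G.real S → (a : ℝ) ∈ Ioo (0 : ℝ) 1) :
    G.real S * M.c a ≤ ∫ y in S, M.c y ∂G ∧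
      (∫ y in S, M.c y ∂G ≤ G.real S * M.c a → ∀ᵐ y ∂G, y ∈ S → y = a) := by
  rcases (measureReal_nonneg : 0 ≤ G.real S).eq_or_lt with h0 | hpos
  · have hz := (measureReal_eq_zero_iff (measure_ne_top _ _)).1 h0.symm
    refine ⟨?_, fun _ => ?_⟩
    · rw [← h0, zero_mul, setIntegral_measure_zero _ hz]
    · filter_upwards [measure_eq_zero_iff_ae_notMem.1 hz] with y hy h using absurd h hy
  · have haI := haI hpos
    set g : unitInterval → ℝ := fun y =>
      M.c y - ((M.c a - deriv M.c a * a) + deriv M.c a * (y : ℝ)) with hg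
    have hgi : IntegrableOn g S G := by
      refine ((M.integrable_c G).sub ?_).integrableOn
      exact Continuous.integrable_unitInterval (by fun_prop) G
    have hglt : ∀ y : unitInterval, (y : ℝ) ∈ Ioo (0 : ℝ) 1 → y ≠ a → 0 < g y := by
      intro y hy hne
      have := M.strictConvex_c.tangent_lt hy haI (M.differentiableAt_c haI)
        (fun h => hne (Subtype.ext h))
      simp only [hg]
      linarith
    have hg0 : 0 ≤ᵐ[G.restrict S] g := by
      filter_upwards [ae_restrict_of_ae hI] with y hy
      by_cases h : y = a
      · simp only [hg, h, Pi.zero_apply]; linarith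
      · exact (hglt y hy h).le
    have hgint : ∫ y in S, g y ∂G = ∫ y in S, M.c y ∂G - G.real S * M.c a := by
      have h1 := setIntegral_sub_condMean ha (M.c a - deriv M.c a * a) (deriv M.c a)
      rw [hg, integral_sub (M.integrable_c G).integrableOn
        (Continuous.integrable_unitInterval (by fun_prop) G).integrableOn, h1]
      ring
    refine ⟨?_, fun hle => ?_⟩
    · have := integral_nonneg_of_ae hg0
      linarith
    · have h0 : ∫ y in S, g y ∂G = 0 :=
        le_antisymm (by linarith) (integral_nonneg_of_ae hg0)
      have h1 := (integral_eq_zero_iff_of_nonneg_ae hg0 hgi).1 h0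
      have h2 : ∀ᵐ y ∂G, y ∈ S → g y = 0 := (ae_restrict_iff' hS).1 h1
      filter_upwards [h2, hI] with y hy hyI hyS
      by_contra hne
      exact (hglt y hyI hne).ne' (hy hyS)

/-- Replacing a mean-preserving contraction `G` of the prior by the conditional means on the two
sides of the certification threshold raises the value of the sender's problem, strictly unless `G`
is already concentrated on these means. -/
theorem exists_coarsening {G : Measure unitInterval} (hG : IsMPC M.F G) {α : ℝ} (hα : 0 ≤ α) :
    ∃ a b p : unitInterval, IsMPC M.F (binary a b p) ∧ (a : ℝ) ≤ α + M.γ ∧ min (α + M.γ) 1 ≤ b ∧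
      G.real {y : unitInterval | (y : ℝ) < α + M.γ} = p ∧
      ∫ y, M.V α y ∂G ≤ ∫ y, M.V α y ∂binary a b p ∧
      (∫ y, M.V α y ∂binary a b p ≤ ∫ y, M.V α y ∂G →
        (∀ᵐ y : unitInterval ∂G, (y : ℝ) < α + M.γ → y = a) ∧
        ∀ᵐ y : unitInterval ∂G, ¬ (y : ℝ) < α + M.γ → y = b) := by
  obtain ⟨hGp, hle, hmean⟩ := isMPC_iff.1 hG
  have hI := hG.ae_mem_Ioo
  set k := α + M.γ with hk
  have hk0 : 0 < k := by have := M.γ_pos; linarith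
  set S : Set unitInterval := {y : unitInterval | (y : ℝ) < k} with hSdef
  have hS : MeasurableSet S := measurableSet_lt (by fun_prop) (by fun_prop)
  -- The defaults 0 and 1 keep the two points on the right sides of the threshold when a cell is
  -- null; `min k 1` allows for a threshold above 1, where the upper cell is empty or null.
  obtain ⟨a, ha, hab⟩ := exists_condMean G hS 0
  obtain ⟨b, hb, hbb⟩ := exists_condMean G hS.compl 1
  have hak : (a : ℝ) ≤ k := (hab 0 k (fun y hy => ⟨y.2.1, le_of_lt hy⟩) (by simp) (by simpa using hk0.le)).2
  have hbk : min k 1 ≤ b := (hbb (min k 1) 1 (fun y hy =>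
    ⟨min_le_of_left_le (not_lt.1 hy), y.2.2⟩) (by simp) (by simp)).1
  set p : unitInterval := ⟨G.real S, measureReal_nonneg, measureReal_le_one⟩ with hp
  have hpS : G.real S = p := rfl
  have hpSc : G.real Sᶜ = 1 - p := by rw [probReal_compl_eq_one_sub hS]
  have hsplit : ∀ f : unitInterval → ℝ, Integrable f G →
      ∫ y in S, f y ∂G + ∫ y in Sᶜ, f y ∂G = ∫ y, f y ∂G := fun f hf => integral_add_compl hS hf
  have hmpc : IsMPC M.F (binary a b p) := by
    rw [isMPC_binary_iff]
    refine ⟨fun x hx => le_trans ?_ (hle x hx), ?_⟩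
    · rw [← hsplit _ (Continuous.integrable_unitInterval (by fun_prop) G), ← hpSc, ← hpS]
      exact add_le_add (condMean_mul_max_le hS ha x) (condMean_mul_max_le hS.compl hb x)
    · rw [← hpSc, ← hpS, ← ha, ← hb, hsplit _ (continuous_subtype_val.integrable_unitInterval G), hmean]
  obtain ⟨haI, hbI⟩ := ae_binary_iff.1 hmpc.ae_mem_Ioo
  have hbI' : 0 < G.real Sᶜ → (b : ℝ) ∈ Ioo (0 : ℝ) 1 := fun h => hbI (by linarith)
  obtain ⟨ca, ca'⟩ := M.condMean_mul_c_le hI hS ha haI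
  obtain ⟨cb, cb'⟩ := M.condMean_mul_c_le hI hS.compl hb hbI'
  have hV : ∫ y, M.V α y ∂G
      = p * α + (1 - p) * (b - M.γ) - M.κ * (∫ y in S, M.c y ∂G + ∫ y in Sᶜ, M.c y ∂G) := by
    simp_rw [V_eq]
    rw [integral_sub (M.integrable_max α G) ((M.integrable_c G).const_mul _), integral_const_mul,
      hsplit _ (M.integrable_c G), ← hsplit _ (M.integrable_max α G)]
    congr 2
    · rw [← hpS, ← smul_eq_mul, ← setIntegral_const]
      exact setIntegral_congr_fun hS fun y hy => max_eq_left (by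
        have : (y : ℝ) < k := hy
        linarith)
    · have := setIntegral_sub_condMean hb (-M.γ) 1
      rw [← hpSc, show (b : ℝ) - M.γ = -M.γ + 1 * b by ring, ← this]
      refine setIntegral_congr_fun hS.compl fun y hy => ?_
      have : k ≤ (y : ℝ) := not_lt.1 hy
      rw [max_eq_right (by linarith)]
      ring
  have hVb : ∫ y, M.V α y ∂binary a b p
      = p * α + (1 - p) * (b - M.γ) - M.κ * (p * M.c a + (1 - p) * M.c b) := by
    rw [integral_binary, V_eq, V_eq, max_eq_left (show (a : ℝ) - M.γ ≤ α by linarith)]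
    -- If the upper point carries mass it is below 1, so `min k 1 ≤ b` becomes `k ≤ b`; otherwise
    -- its payoff does not count.
    rcases p.2.2.eq_or_lt with h1 | h1
    · rw [h1]; ring
    · have hb1 := hbI h1
      have hkb : k ≤ b := by
        rcases le_total k 1 with h | h
        · rwa [min_eq_left h] at hbk
        · rw [min_eq_right h] at hbk
          exact absurd hb1.2 (not_lt.2 hbk)
      rw [max_eq_right (show α ≤ (b : ℝ) - M.γ by linarith)]
      ring
  rw [hpS] at ca ca'
  rw [hpSc] at cb cb'
  have hκ := M.κ_pos
  refine ⟨a, b, p, hmpc, hak, hbk, rfl, ?_, fun h => ?_⟩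
  · rw [hV, hVb]
    have := mul_le_mul_of_nonneg_left (add_le_add ca cb) hκ.le
    linarith
  · rw [hV, hVb] at h
    have h2 : ∫ y in S, M.c y ∂G + ∫ y in Sᶜ, M.c y ∂G ≤ p * M.c a + (1 - p) * M.c b :=
      le_of_mul_le_mul_left (by linarith) hκ
    exact ⟨ca' (by linarith), cb' (by linarith)⟩

end DisclosureModel

/-! ### Existence, uniqueness and continuity of the sender's solution -/

namespace DisclosureModel

variable (M : DisclosureModel)

theorem isMPC_self : IsMPC M.F M.F := ⟨inferInstance, fun _ _ => le_rfl, rfl⟩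

/-- The triples `(a, b, p)` whose binary distribution is a mean-preserving contraction of the
prior. -/
def feasible : Set (unitInterval × unitInterval × unitInterval) :=
  {t | IsMPC M.F (binary t.1 t.2.1 t.2.2)}

theorem isClosed_feasible : IsClosed M.feasible := by
  have : M.feasible = (⋂ x ∈ Icc (0 : ℝ) 1, {t | (t.2.2 : ℝ) * max (x - t.1) 0
      + (1 - t.2.2) * max (x - t.2.1) 0 ≤ ∫ y : unitInterval, max (x - y) 0 ∂M.F}) ∩
      {t | (t.2.2 : ℝ) * t.1 + (1 - t.2.2) * t.2.1 = ∫ y : unitInterval, (y : ℝ) ∂M.F} := by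
    ext t
    simp only [feasible, mem_ofPred_eq, isMPC_binary_iff, mem_inter_iff, mem_iInter]
  rw [this]
  refine IsClosed.inter (isClosed_biInter fun x _ => isClosed_le (by fun_prop) (by fun_prop)) ?_
  exact isClosed_eq (by fun_prop) (by fun_prop)

/-- The value of the sender's problem at the binary distribution given by a triple. -/
def objective (α : ℝ) (t : unitInterval × unitInterval × unitInterval) : ℝ :=
  ∫ y, M.V α y ∂binary t.1 t.2.1 t.2.2

/-- At an endpoint, where `c` may be discontinuous, a vanishing weight times a bounded function
still tends to zero. At a feasible triple each point is interior or has zero weight, so one of the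
two alternatives always applies. -/
theorem continuousWithinAt_mul_c {X : Type*} [TopologicalSpace X] {s : Set X} {x : X} {w : X → ℝ}
    {f : X → unitInterval} (hw : ContinuousWithinAt w s x) (hf : ContinuousWithinAt f s x)
    (h : w x = 0 ∨ (f x : ℝ) ∈ Ioo (0 : ℝ) 1) :
    ContinuousWithinAt (fun z => w z * M.c (f z)) s x := by
  rcases h with h | h
  · obtain ⟨B, hB0, hB⟩ := M.exists_bound_c
    rw [ContinuousWithinAt, h, zero_mul]
    refine squeeze_zero_norm (a := fun z => ‖w z‖ * B) (fun z => ?_) ?_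
    · rw [norm_mul]
      exact mul_le_mul_of_nonneg_left (hB _) (norm_nonneg _)
    · have := (hw.norm.mul_const B)
      simpa [ContinuousWithinAt, h] using this
  · exact hw.mul (ContinuousAt.comp_continuousWithinAt (f := fun z => (f z : ℝ))
      (M.differentiableAt_c h).continuousAt (continuous_subtype_val.continuousAt.comp_continuousWithinAt hf))

theorem continuousOn_objective :
    ContinuousOn (fun z : ℝ × unitInterval × unitInterval × unitInterval => M.objective z.1 z.2)
      (univ ×ˢ M.feasible) := by
  intro z hz
  obtain ⟨ha, hb⟩ := ae_binary_iff.1 (IsMPC.ae_mem_Ioo hz.2)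
  have e : ∀ z : ℝ × unitInterval × unitInterval × unitInterval, M.objective z.1 z.2
      = (z.2.2.2 * max z.1 (z.2.1 - M.γ) + (1 - z.2.2.2) * max z.1 (z.2.2.1 - M.γ))
        - M.κ * (z.2.2.2 * M.c z.2.1 + (1 - z.2.2.2) * M.c z.2.2.1) := by
    intro z
    rw [objective, integral_binary, V_eq, V_eq]
    ring
  simp_rw [e]
  refine ContinuousWithinAt.sub (Continuous.continuousWithinAt (by fun_prop))
    (continuousWithinAt_const.mul (ContinuousWithinAt.add ?_ ?_))
  · refine M.continuousWithinAt_mul_c (w := fun z : ℝ × unitInterval × unitInterval × unitInterval => (z.2.2.2 : ℝ))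
      (f := fun z => z.2.1) (Continuous.continuousWithinAt (by fun_prop))
      (Continuous.continuousWithinAt (by fun_prop)) ?_
    rcases z.2.2.2.2.1.eq_or_lt with h | h
    · exact Or.inl h.symm
    · exact Or.inr (ha h)
  · refine M.continuousWithinAt_mul_c (w := fun z : ℝ × unitInterval × unitInterval × unitInterval => 1 - (z.2.2.2 : ℝ))
      (f := fun z => z.2.2.1)
      (Continuous.continuousWithinAt (by fun_prop)) (Continuous.continuousWithinAt (by fun_prop)) ?_
    rcases z.2.2.2.2.2.eq_or_lt with h | h
    · exact Or.inl (by rw [h, sub_self])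
    · exact Or.inr (hb h)

/-- By pooling, a binary distribution that beats all binary contractions beats all contractions. -/
theorem isSolution_binary_iff {α : ℝ} (hα : 0 ≤ α)
    {t : unitInterval × unitInterval × unitInterval} :
    M.IsSolution α (binary t.1 t.2.1 t.2.2) ↔
      t ∈ M.feasible ∧ ∀ t' ∈ M.feasible, M.objective α t' ≤ M.objective α t := by
  refine and_congr_right fun _ => ⟨fun h t' ht' => h _ ht', fun h G hG => ?_⟩
  obtain ⟨a, b, p, hf, -, -, -, hle, -⟩ := M.exists_coarsening hG hα
  exact hle.trans (h (a, b, p) hf)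

/-- The pairs of `α` and a triple whose binary distribution solves the problem for `α`, with `a`
below and `b` above the certification threshold. -/
def optimal : Set (ℝ × unitInterval × unitInterval × unitInterval) :=
  {z | 0 ≤ z.1 ∧ (z.2.1 : ℝ) ≤ z.1 + M.γ ∧ min (z.1 + M.γ) 1 ≤ z.2.2.1 ∧
    M.IsSolution z.1 (binary z.2.1 z.2.2.1 z.2.2.2)}

theorem isClosed_optimal : IsClosed M.optimal := by
  have hK : IsClosed ((univ : Set ℝ) ×ˢ M.feasible) := isClosed_univ.prod M.isClosed_feasible
  -- The objective is known to be continuous only over feasible triples, so each optimality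
  -- inequality is intersected with that closed set.
  have : M.optimal = {z | 0 ≤ z.1} ∩ {z | (z.2.1 : ℝ) ≤ z.1 + M.γ} ∩
      {z | min (z.1 + M.γ) 1 ≤ (z.2.2.1 : ℝ)} ∩ (univ ×ˢ M.feasible ∩ ⋂ t ∈ M.feasible,
        {z | z ∈ univ ×ˢ M.feasible ∧ M.objective z.1 t ≤ M.objective z.1 z.2}) := by
    ext z
    simp only [optimal, mem_ofPred_eq, mem_inter_iff, mem_iInter, mem_prod, mem_univ, true_and]
    constructor
    · rintro ⟨h0, h1, h2, h3⟩
      obtain ⟨h4, h5⟩ := (M.isSolution_binary_iff h0).1 h3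
      exact ⟨⟨⟨h0, h1⟩, h2⟩, h4, fun t ht => ⟨h4, h5 t ht⟩⟩
    · rintro ⟨⟨⟨h0, h1⟩, h2⟩, h4, h5⟩
      exact ⟨h0, h1, h2, (M.isSolution_binary_iff h0).2 ⟨h4, fun t ht => (h5 t ht).2⟩⟩
  rw [this]
  refine IsClosed.inter (IsClosed.inter (IsClosed.inter ?_ ?_) ?_) (hK.inter (isClosed_biInter
    fun t ht => hK.isClosed_le ?_ M.continuousOn_objective))
  · exact isClosed_le (by fun_prop) (by fun_prop)
  · exact isClosed_le (by fun_prop) (by fun_prop)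
  · exact isClosed_le (by fun_prop) (by fun_prop)
  · exact M.continuousOn_objective.comp
      (f := fun z : ℝ × unitInterval × unitInterval × unitInterval => (z.1, t)) (Continuous.continuousOn (by fun_prop))
      fun z _ => ⟨mem_univ _, ht⟩

theorem exists_optimal {α : ℝ} (hα : 0 ≤ α) : ∃ t, (α, t) ∈ M.optimal := by
  obtain ⟨a₀, b₀, p₀, h₀, -⟩ := M.exists_coarsening M.isMPC_self hα
  obtain ⟨t, ht, hmax⟩ := M.isClosed_feasible.isCompact.exists_isMaxOn ⟨(a₀, b₀, p₀), h₀⟩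
    (M.continuousOn_objective.comp (f := fun t => (α, t)) (Continuous.continuousOn (by fun_prop))
      fun t ht => ⟨mem_univ _, ht⟩)
  -- A maximizing triple need not have its points on the right sides of the threshold; pooling once
  -- more places them there at no loss.
  obtain ⟨a, b, p, hf, ha, hb, -, hle, -⟩ := M.exists_coarsening ht hα
  refine ⟨(a, b, p), hα, ha, hb, (M.isSolution_binary_iff hα (t := (a, b, p))).2 ⟨hf, fun t' ht' => ?_⟩⟩
  exact (hmax ht').trans hle

/-- The average of two solutions is feasible and does at least as well as its own pooling. The
equality case puts the average, hence both solutions, on the same point of each side; the common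
mean then fixes the weight, unless the two points coincide. -/
theorem IsSolution.eq {M : DisclosureModel} {α : ℝ} (hα : 0 ≤ α) {H H' : Measure unitInterval}
    (h : M.IsSolution α H) (h' : M.IsSolution α H') : H = H' := by
  obtain ⟨hp, hle, hm⟩ := isMPC_iff.1 h.1
  obtain ⟨hp', hle', hm'⟩ := isMPC_iff.1 h'.1
  have hhalf : (2⁻¹ : ENNReal) ≠ ⊤ := by simp
  set A : Measure unitInterval := (2⁻¹ : ENNReal) • H + (2⁻¹ : ENNReal) • H' with hA
  have hAp : IsProbabilityMeasure A := ⟨by simp [hA, ENNReal.inv_two_add_inv_two]⟩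
  have hint : ∀ f : unitInterval → ℝ, Integrable f H → Integrable f H' →
      ∫ y, f y ∂A = 2⁻¹ * ∫ y, f y ∂H + 2⁻¹ * ∫ y, f y ∂H' := by
    intro f hf hf'
    rw [hA, integral_add_measure (hf.smul_measure hhalf) (hf'.smul_measure hhalf),
      integral_smul_measure, integral_smul_measure]
    simp
  have hAmpc : IsMPC M.F A := by
    refine isMPC_iff.2 ⟨hAp, fun x hx => ?_, ?_⟩
    · rw [hint _ (Continuous.integrable_unitInterval (by fun_prop) H)
        (Continuous.integrable_unitInterval (by fun_prop) H')]
      linarith [hle x hx, hle' x hx]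
    · rw [hint _ (Continuous.integrable_unitInterval (by fun_prop) H)
        (Continuous.integrable_unitInterval (by fun_prop) H'), hm, hm']
      ring
  obtain ⟨a, b, p, hf, -, -, -, -, heq⟩ := M.exists_coarsening hAmpc hα
  have hAV := hint _ (M.integrable_V α H) (M.integrable_V α H')
  obtain ⟨ha, hb⟩ := heq (by linarith [h.2 _ hf, h'.2 _ hf])
  have h2 : (2⁻¹ : ENNReal) ≠ 0 := by simp
  simp only [hA, ae_add_measure_iff, Measure.ae_ennreal_smul_measure_iff h2] at ha hb
  have hS : MeasurableSet {y : unitInterval | (y : ℝ) < α + M.γ} :=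
    measurableSet_lt (by fun_prop) (by fun_prop)
  have e := eq_binary (p := ⟨_, measureReal_nonneg, measureReal_le_one⟩) hS rfl ha.1 hb.1
  have e' := eq_binary (p := ⟨_, measureReal_nonneg, measureReal_le_one⟩) hS rfl ha.2 hb.2
  rw [e, integral_binary] at hm
  rw [e', integral_binary] at hm'
  simp only at hm hm'
  by_cases hab : a = b
  · rw [e, e', hab]
    ext s hs
    simp only [binary_apply, ← add_mul]
    rw [← ENNReal.ofReal_add measureReal_nonneg (by linarith [measureReal_le_one (μ := H) (s := {y : unitInterval | (y : ℝ) < α + M.γ})]),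
      ← ENNReal.ofReal_add measureReal_nonneg (by linarith [measureReal_le_one (μ := H') (s := {y : unitInterval | (y : ℝ) < α + M.γ})])]
    simp
  · have hne : (a : ℝ) - b ≠ 0 := fun h => hab (Subtype.ext (by linarith))
    have : H.real {y : unitInterval | (y : ℝ) < α + M.γ}
        = H'.real {y : unitInterval | (y : ℝ) < α + M.γ} :=
      mul_right_cancel₀ hne (by linarith)
    rw [e, e']
    congr 1
    exact Subtype.ext this

/-- A function that selects the lower point of the optimal triples is continuous where this point is
unique. -/
theorem continuousOn_of_optimal {X : Set ℝ} {f : ℝ → ℝ} (hX : X ⊆ Ici 0)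
    (h : ∀ α ∈ X, ∀ t, (α, t) ∈ M.optimal → (t.1 : ℝ) = f α) : ContinuousOn f X := by
  rw [continuousOn_iff_isClosed]
  intro C hC
  -- Projection along the compact space of triples is a closed map, so this image is closed; on `X`
  -- it is the preimage of `C`.
  refine ⟨Prod.fst '' (M.optimal ∩ {z | (z.2.1 : ℝ) ∈ C}),
    isClosedMap_fst_of_compactSpace _ (M.isClosed_optimal.inter (hC.preimage (by fun_prop))), ?_⟩
  ext α
  refine and_congr_left fun hα => ⟨fun hf => ?_, ?_⟩
  · obtain ⟨t, ht⟩ := M.exists_optimal (hX hα)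
    exact ⟨(α, t), ⟨ht, by simpa [h α hα t ht] using hf⟩, rfl⟩
  · rintro ⟨⟨α', t⟩, ⟨ht, htC⟩, rfl⟩
    simpa [h _ hα t ht] using htC

theorem lowerSupport_binary {a b p : unitInterval} (hab : (a : ℝ) ≤ b)
    (h : (binary a b p).support.encard = 2) : lowerSupport (binary a b p) = a := by
  have hs := support_binary_subset a b p
  have he : (binary a b p).support = {a, b} := by
    refine Set.Finite.eq_of_subset_of_encard_le ((Set.toFinite {a, b}).subset hs) hs ?_
    rw [h]
    exact (encard_insert_le {b} a).trans (by rw [encard_singleton]; norm_num)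
  rw [lowerSupport, he, image_pair, csInf_pair, min_eq_left hab]

theorem le_of_mem_optimal {z : ℝ × unitInterval × unitInterval × unitInterval}
    (hz : z ∈ M.optimal) : (z.2.1 : ℝ) ≤ z.2.2.1 := by
  refine le_trans ?_ hz.2.2.1
  exact le_min hz.2.1 z.2.1.2.2

theorem exists_unique_solution :
    ∃ G : ℝ → Measure unitInterval,
      (∀ α ∈ Set.Icc (0 : ℝ) M.mean,
        (∀ H : Measure unitInterval, M.IsSolution α H ↔ H = G α) ∧ (G α).support.encard ≤ 2) ∧
      ContinuousOn (fun α => lowerSupport (G α))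
        {α | α ∈ Set.Icc (0 : ℝ) M.mean ∧ (G α).support.encard = 2} := by
  have hex : ∀ α : ℝ, ∃ t, 0 ≤ α → (α, t) ∈ M.optimal := by
    intro α
    by_cases hα : 0 ≤ α
    · obtain ⟨t, ht⟩ := M.exists_optimal hα
      exact ⟨t, fun _ => ht⟩
    · exact ⟨(0, 0, 0), fun h => absurd h hα⟩
  choose t ht using hex
  refine ⟨fun α => binary (t α).1 (t α).2.1 (t α).2.2, fun α hα => ⟨fun H => ?_, ?_⟩, ?_⟩
  · have hs := (ht α hα.1).2.2.2
    exact ⟨fun h => h.eq hα.1 hs, fun h => h ▸ hs⟩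
  · refine (encard_le_encard (support_binary_subset _ _ _)).trans ?_
    exact (encard_insert_le _ _).trans (by rw [encard_singleton]; norm_num)
  · refine M.continuousOn_of_optimal (fun α hα => hα.1.1) fun α hα t' ht' => ?_
    have heq := ht'.2.2.2.eq hα.1.1 (ht α hα.1.1).2.2.2
    simp only at heq ⊢
    rw [← heq]
    exact (lowerSupport_binary (M.le_of_mem_optimal ht') (heq ▸ hα.2)).symm

end DisclosureModel

/-! ### Signals and mean-preserving contractions -/

namespace DisclosureModel

variable {M : DisclosureModel}

instance (π : M.Signal) : IsProbabilityMeasure π.posteriorLaw := by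
  unfold Signal.posteriorLaw; infer_instance

theorem Signal.snd_joint (π : M.Signal) : (M.F ⊗ₘ π.kernel).map Prod.snd = π.posteriorLaw :=
  Measure.snd_compProd M.F π.kernel

/-- On an event about the realization, the state and the realization have the same integral. -/
theorem Signal.setIntegral_state (π : M.Signal) {B : Set unitInterval} (hB : MeasurableSet B) :
    ∫ z in Prod.snd ⁻¹' B, (z.1 : ℝ) ∂(M.F ⊗ₘ π.kernel) = ∫ y in B, (y : ℝ) ∂π.posteriorLaw := by
  have hle : MeasurableSpace.comap (Prod.snd : unitInterval × unitInterval → unitInterval)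
      (inferInstance : MeasurableSpace unitInterval)
      ≤ (inferInstance : MeasurableSpace (unitInterval × unitInterval)) := measurable_snd.comap_le
  have hint : Integrable (fun z : unitInterval × unitInterval => (z.1 : ℝ)) (M.F ⊗ₘ π.kernel) :=
    Continuous.integrable_of_hasCompactSupport (by fun_prop) (HasCompactSupport.of_compactSpace _)
  rw [← setIntegral_condExp hle hint ⟨B, hB, rfl⟩, setIntegral_congr_ae (measurable_snd hB)
    (π.posteriorMean.mono fun z hz _ => hz), ← π.snd_joint,
    setIntegral_map hB (by fun_prop) (by fun_prop)]

theorem setIntegral_max_sub (G : Measure unitInterval) [IsFiniteMeasure G] (x : ℝ) :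
    ∫ y : unitInterval, max (x - y) 0 ∂G
      = x * G.real {y : unitInterval | (y : ℝ) ≤ x} - ∫ y in {y : unitInterval | (y : ℝ) ≤ x}, (y : ℝ) ∂G := by
  have hS : MeasurableSet {y : unitInterval | (y : ℝ) ≤ x} :=
    measurableSet_le (by fun_prop) (by fun_prop)
  have h : ∀ y : unitInterval, max (x - (y : ℝ)) 0
      = {y : unitInterval | (y : ℝ) ≤ x}.indicator (fun y : unitInterval => x - (y : ℝ)) y := by
    intro y
    simp only [indicator, mem_ofPred_eq]
    split_ifs with h
    · exact max_eq_left (by linarith)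
    · exact max_eq_right (by linarith)
  simp_rw [h]
  rw [integral_indicator hS, integral_sub (integrable_const _).integrableOn
    (continuous_subtype_val.integrable_unitInterval G).integrableOn, setIntegral_const, smul_eq_mul,
    mul_comm]

/-- For a realization `X`, the posterior-mean property gives `E max(x - X, 0) = E[(x - θ); X ≤ x] ≤
E max(x - θ, 0)`. -/
theorem Signal.isMPC (π : M.Signal) : IsMPC M.F π.posteriorLaw := by
  have hjoint : ∀ f : unitInterval → ℝ, Continuous f →
      ∫ z, f z.1 ∂(M.F ⊗ₘ π.kernel) = ∫ y, f y ∂M.F := by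
    intro f hf
    have : (M.F ⊗ₘ π.kernel).map Prod.fst = M.F := Measure.fst_compProd M.F π.kernel
    conv_rhs => rw [← this]
    rw [integral_map (by fun_prop) hf.aestronglyMeasurable]
  have hint : ∀ f : unitInterval × unitInterval → ℝ, Continuous f →
      Integrable f (M.F ⊗ₘ π.kernel) := fun f hf =>
    hf.integrable_of_hasCompactSupport (HasCompactSupport.of_compactSpace _)
  refine isMPC_iff.2 ⟨inferInstance, fun x _ => ?_, ?_⟩
  · have hS : MeasurableSet {y : unitInterval | (y : ℝ) ≤ x} :=
      measurableSet_le (by fun_prop) (by fun_prop)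
    rw [setIntegral_max_sub, ← π.setIntegral_state hS, ← hjoint _ (by fun_prop)]
    have h1 : x * π.posteriorLaw.real {y : unitInterval | (y : ℝ) ≤ x}
        = ∫ z in Prod.snd ⁻¹' {y : unitInterval | (y : ℝ) ≤ x}, x ∂(M.F ⊗ₘ π.kernel) := by
      rw [setIntegral_const, smul_eq_mul, mul_comm, ← π.snd_joint,
        map_measureReal_apply measurable_snd hS]
    rw [h1, ← integral_sub (integrable_const _).integrableOn (hint _ (by fun_prop)).integrableOn]
    calc ∫ z in Prod.snd ⁻¹' {y : unitInterval | (y : ℝ) ≤ x}, (x - (z.1 : ℝ)) ∂(M.F ⊗ₘ π.kernel)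
        ≤ ∫ z in Prod.snd ⁻¹' {y : unitInterval | (y : ℝ) ≤ x}, max (x - (z.1 : ℝ)) 0
            ∂(M.F ⊗ₘ π.kernel) :=
          setIntegral_mono (hint _ (by fun_prop)).integrableOn (hint _ (by fun_prop)).integrableOn
            fun z => le_max_left _ _
      _ ≤ _ := setIntegral_le_integral (hint _ (by fun_prop)) (ae_of_all _ fun z => le_max_right _ _)
  · have := π.setIntegral_state MeasurableSet.univ
    rw [preimage_univ, setIntegral_univ, setIntegral_univ] at this
    rw [← this, hjoint _ (by fun_prop)]

theorem continuous_cdfOn (F : Measure unitInterval) [IsProbabilityMeasure F] [NullSingletonClass F] :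
    Continuous (cdfOn F) := by
  have h : cdfOn F = fun s => ∫ y, (Iic s).indicator (fun _ => (1 : ℝ)) (y : ℝ) ∂F := by
    ext s
    have : (fun y : unitInterval => (Iic s).indicator (fun _ => (1 : ℝ)) (y : ℝ))
        = {y : unitInterval | (y : ℝ) ≤ s}.indicator 1 := by
      ext y; simp [indicator]
    rw [this, integral_indicator_one (measurableSet_le (by fun_prop) (by fun_prop)), cdfOn]
  rw [h, continuous_iff_continuousAt]
  intro s
  refine continuousAt_of_dominated (bound := fun _ => 1) (Filter.Eventually.of_forall fun r => ?_)
    (Filter.Eventually.of_forall fun r => ae_of_all _ fun y => ?_) (integrable_const _) ?_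
  · exact ((measurable_const.indicator measurableSet_Iic).comp
      measurable_subtype_coe).aestronglyMeasurable
  · simp only [indicator]; split_ifs <;> simp
  · have hne : ∀ᵐ y : unitInterval ∂F, (y : ℝ) ≠ s := by
      by_cases hs : s ∈ unitInterval
      · filter_upwards [measure_eq_zero_iff_ae_notMem.1 (measure_singleton (μ := F) ⟨s, hs⟩)] with y hy h
        exact hy (Subtype.ext h)
      · exact ae_of_all _ fun y h => hs (h ▸ y.2)
    filter_upwards [hne] with y hy
    rcases lt_or_gt_of_ne hy with h | h
    · refine continuousAt_const.congr (f := fun _ => (1 : ℝ)) ?_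
      filter_upwards [Ioi_mem_nhds h] with r hr
      have : (y : ℝ) ≤ r := le_of_lt hr
      simp [indicator, this]
    · refine continuousAt_const.congr (f := fun _ => (0 : ℝ)) ?_
      filter_upwards [Iio_mem_nhds h] with r hr
      have : ¬ (y : ℝ) ≤ r := not_le.2 hr
      simp [indicator, this]

/-- If the binary distribution is a mean-preserving contraction of `F`, the states can be sent to
its two points with the right probabilities and conditional means. -/
theorem exists_weight {F : Measure unitInterval} [IsProbabilityMeasure F] [NullSingletonClass F]
    {a b p : unitInterval} (hab : (a : ℝ) ≤ b) (h : IsMPC F (binary a b p)) :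
    ∃ w : unitInterval → unitInterval, Measurable w ∧ ∫ y, (w y : ℝ) ∂F = p ∧
      ∫ y : unitInterval, (w y : ℝ) * y ∂F = p * a := by
  obtain ⟨hle, hmean⟩ := isMPC_binary_iff.1 h
  -- With `s` a `p`-quantile, sending the lower tail to `a` gives state integral at most `p * a`, by
  -- the contraction inequality at `s`. Sending every state there with probability `p` gives at
  -- least `p * a`, as `a` is at most the mean. A mixture of the two rules hits `p * a`.
  obtain ⟨s, hs, hsp⟩ : (p : ℝ) ∈ cdfOn F '' Icc 0 1 := by
    refine intermediate_value_Icc zero_le_one (continuous_cdfOn F).continuousOn ⟨?_, ?_⟩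
    · have : {x : unitInterval | (x : ℝ) ≤ 0} ⊆ {0} :=
        fun y hy => Subtype.ext (le_antisymm hy y.2.1)
      rw [cdfOn, Measure.real, measure_mono_null this (measure_singleton _)]
      exact p.2.1
    · have : {x : unitInterval | (x : ℝ) ≤ 1} = univ := eq_univ_of_forall fun y => y.2.2
      rw [cdfOn, this, probReal_univ]
      exact p.2.2
  set S : Set unitInterval := {y : unitInterval | (y : ℝ) ≤ s} with hSdef
  have hS : MeasurableSet S := measurableSet_le (by fun_prop) (by fun_prop)
  have hFS : F.real S = p := hsp
  have hI := setIntegral_max_sub F s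
  have h1 : ∫ y in S, (y : ℝ) ∂F ≤ p * a := by
    have h2 := hle s hs
    rw [hI, hFS] at h2
    have h3 : (p : ℝ) * (s - a) ≤ p * max (s - a) 0 :=
      mul_le_mul_of_nonneg_left (le_max_left _ _) p.2.1
    have h4 : 0 ≤ (1 - (p : ℝ)) * max (s - b) 0 :=
      mul_nonneg (by linarith [p.2.2]) (le_max_right _ _)
    linarith
  have h2 : (p : ℝ) * a ≤ p * ∫ y : unitInterval, (y : ℝ) ∂F := by
    refine mul_le_mul_of_nonneg_left ?_ p.2.1
    rw [← hmean]
    nlinarith [mul_nonneg (sub_nonneg.2 p.2.2) (sub_nonneg.2 hab)]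
  obtain ⟨l, m, hl, hm, hlm, hlc⟩ := Icc_subset_segment (𝕜 := ℝ) ⟨h1, h2⟩
  simp only [smul_eq_mul] at hlc
  set f : unitInterval → ℝ := fun y => l * S.indicator 1 y + m * p with hf
  have hf01 : ∀ y, f y ∈ Icc (0 : ℝ) 1 := by
    intro y
    have hi : (0 : ℝ) ≤ S.indicator 1 y ∧ S.indicator 1 y ≤ (1 : ℝ) := by
      simp only [indicator]; split_ifs <;> simp
    constructor
    · exact add_nonneg (mul_nonneg hl hi.1) (mul_nonneg hm p.2.1)
    · have h3 := mul_le_mul_of_nonneg_left hi.2 hl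
      have h4 := mul_le_mul_of_nonneg_left p.2.2 hm
      simp only [hf]
      linarith
  have hi1 : Integrable (S.indicator (1 : unitInterval → ℝ)) F :=
    (integrable_const (1 : ℝ)).indicator hS
  have hiy := continuous_subtype_val.integrable_unitInterval F
  refine ⟨fun y => ⟨f y, hf01 y⟩, ?_, ?_, ?_⟩
  · exact Measurable.subtype_mk (((measurable_one.indicator hS).const_mul l).add_const _)
  · simp only [hf]
    rw [integral_add (hi1.const_mul l) (integrable_const _), integral_const_mul,
      integral_indicator_one hS, hFS, integral_const, probReal_univ, one_smul, ← add_mul, hlm, one_mul]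
  · have : ∀ y : unitInterval, f y * y
        = l * S.indicator (fun y : unitInterval => (y : ℝ)) y + m * p * y := by
      intro y
      by_cases hy : y ∈ S
      · simp only [hf, indicator_of_mem hy, Pi.one_apply]; ring
      · simp only [hf, indicator_of_notMem hy]; ring
    simp only [this]
    rw [integral_add ((hiy.indicator hS).const_mul l) (hiy.const_mul _), integral_const_mul,
      integral_const_mul, integral_indicator hS, mul_assoc]
    exact hlc

/-- The kernel that sends the state `y` to `a` with probability `w y` and to `b` otherwise. -/
def binaryKernel (a b : unitInterval) (w : unitInterval → unitInterval) (hw : Measurable w) :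
    Kernel unitInterval unitInterval where
  toFun y := binary a b (w y)
  measurable' := by
    refine Measure.measurable_of_measurable_coe _ fun s _ => ?_
    simp only [binary_apply]
    have h : Measurable fun y => (w y : ℝ) := measurable_subtype_coe.comp hw
    exact (h.ennreal_ofReal.mul_const _).add ((h.const_sub 1).ennreal_ofReal.mul_const _)

theorem binaryKernel_apply (a b : unitInterval) (w : unitInterval → unitInterval)
    (hw : Measurable w) (y : unitInterval) : binaryKernel a b w hw y = binary a b (w y) := rfl

instance (a b : unitInterval) (w : unitInterval → unitInterval) (hw : Measurable w) :
    IsMarkovKernel (binaryKernel a b w hw) :=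
  ⟨fun y => by rw [binaryKernel_apply]; infer_instance⟩

theorem setIntegral_binaryKernel (F : Measure unitInterval) [IsProbabilityMeasure F]
    {a b : unitInterval} {w : unitInterval → unitInterval} (hw : Measurable w)
    {f : unitInterval × unitInterval → ℝ} (hf : Continuous f) {B : Set unitInterval}
    (hB : MeasurableSet B) :
    ∫ z in Prod.snd ⁻¹' B, f z ∂(F ⊗ₘ binaryKernel a b w hw)
      = B.indicator 1 a * ∫ y, w y * f (y, a) ∂F + B.indicator 1 b * ∫ y, (1 - w y) * f (y, b) ∂F := by
  have hi : Integrable f (F ⊗ₘ binaryKernel a b w hw) :=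
    hf.integrable_of_hasCompactSupport (HasCompactSupport.of_compactSpace _)
  have hwi : ∀ g : unitInterval → ℝ, Continuous g → Integrable (fun y => w y * g y) F := by
    intro g hg
    refine (hg.integrable_unitInterval F).bdd_mul (c := 1)
      (measurable_subtype_coe.comp hw).aestronglyMeasurable (ae_of_all _ fun y => ?_)
    rw [Real.norm_eq_abs, abs_of_nonneg (w y).2.1]
    exact (w y).2.2
  have hwi' : Integrable (fun y => (1 - (w y : ℝ)) * f (y, b)) F := by
    simp_rw [sub_mul, one_mul]
    exact (Continuous.integrable_unitInterval (by fun_prop) F).sub (hwi _ (by fun_prop))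
  have hin : ∀ y, ∫ x in B, f (y, x) ∂binaryKernel a b w hw y
      = B.indicator 1 a * (w y * f (y, a)) + B.indicator 1 b * ((1 - w y) * f (y, b)) := by
    intro y
    rw [← integral_indicator hB, binaryKernel_apply, integral_binary]
    simp only [indicator]
    split_ifs <;> simp
  rw [← univ_prod, Measure.setIntegral_compProd MeasurableSet.univ hB hi.integrableOn,
    setIntegral_univ]
  simp_rw [hin]
  rw [integral_add ((hwi _ (by fun_prop)).const_mul _) (hwi'.const_mul _), integral_const_mul,
    integral_const_mul]

/-- A converse to `Signal.isMPC`, in the binary case that suffices for equilibrium. -/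
theorem exists_signal {a b p : unitInterval} (hab : (a : ℝ) ≤ b) (h : IsMPC M.F (binary a b p)) :
    ∃ π : M.Signal, π.posteriorLaw = binary a b p := by
  obtain ⟨w, hw, hwp, hwa⟩ := exists_weight hab h
  obtain ⟨-, hmean⟩ := isMPC_binary_iff.1 h
  have hwm : Measurable fun y => (w y : ℝ) := measurable_subtype_coe.comp hw
  have hwi : Integrable (fun y => (w y : ℝ)) M.F :=
    Integrable.of_bound hwm.aestronglyMeasurable 1 (ae_of_all _ fun y => by
      rw [Real.norm_eq_abs, abs_of_nonneg (w y).2.1]; exact (w y).2.2)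
  have hyi := continuous_subtype_val.integrable_unitInterval M.F
  have hwyi : Integrable (fun y : unitInterval => (w y : ℝ) * y) M.F :=
    hyi.bdd_mul (c := 1) hwm.aestronglyMeasurable (ae_of_all _ fun y => by
      rw [Real.norm_eq_abs, abs_of_nonneg (w y).2.1]; exact (w y).2.2)
  have hw1 : ∫ y, (1 - (w y : ℝ)) ∂M.F = 1 - p := by
    rw [integral_sub (integrable_const _) hwi, hwp]; simp
  have hwy1 : ∫ y : unitInterval, (1 - (w y : ℝ)) * y ∂M.F = (1 - p) * b := by
    simp_rw [sub_mul, one_mul]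
    rw [integral_sub hyi hwyi, hwa]
    linarith
  refine ⟨⟨binaryKernel a b w hw, inferInstance, ?_⟩, ?_⟩
  · have hle : MeasurableSpace.comap (Prod.snd : unitInterval × unitInterval → unitInterval)
        (inferInstance : MeasurableSpace unitInterval)
        ≤ (inferInstance : MeasurableSpace (unitInterval × unitInterval)) := measurable_snd.comap_le
    have hint : ∀ f : unitInterval × unitInterval → ℝ, Continuous f →
        Integrable f (M.F ⊗ₘ binaryKernel a b w hw) := fun f hf =>
      hf.integrable_of_hasCompactSupport (HasCompactSupport.of_compactSpace _)
    refine (ae_eq_condExp_of_forall_setIntegral_eq hle (hint _ (by fun_prop))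
      (fun s _ _ => (hint _ (by fun_prop)).integrableOn) ?_ ?_).symm
    · rintro s ⟨B, hB, rfl⟩ -
      rw [setIntegral_binaryKernel M.F hw (by fun_prop) hB,
        setIntegral_binaryKernel M.F hw (by fun_prop) hB, hwa, hwy1]
      simp only [integral_mul_const, hwp, hw1]
    · exact (measurable_subtype_coe.comp (comap_measurable _)).aestronglyMeasurable
  · ext s hs
    have e1 : ∫⁻ y, ENNReal.ofReal (w y) ∂M.F = ENNReal.ofReal p := by
      rw [← ofReal_integral_eq_lintegral_ofReal hwi (ae_of_all _ fun y => (w y).2.1), hwp]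
    have e2 : ∫⁻ y, ENNReal.ofReal (1 - w y) ∂M.F = ENNReal.ofReal (1 - p) := by
      rw [← ofReal_integral_eq_lintegral_ofReal (f := fun y => 1 - (w y : ℝ))
        ((integrable_const _).sub hwi)
        (ae_of_all _ fun y => sub_nonneg.2 (w y).2.2), hw1]
    rw [Signal.posteriorLaw, Measure.bind_apply hs (Kernel.aemeasurable _)]
    simp only [binaryKernel_apply, binary_apply]
    rw [lintegral_add_left (hwm.ennreal_ofReal.mul_const _), lintegral_mul_const _ hwm.ennreal_ofReal,
      lintegral_mul_const _ (hwm.const_sub 1).ennreal_ofReal, e1, e2]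

end DisclosureModel

/-! ### Disclosure rules -/

theorem measurableSet_noCert : MeasurableSet ({noCert} : Set Message) := by
  have : ({noCert} : Set Message) = Sum.inr '' univ := by
    rw [image_univ, range_unique]
  rw [this]
  exact MeasurableSet.inr_image MeasurableSet.univ

namespace DisclosureRule

/-- Replaces the probability of the event `{Sum.inl x}`, which moves with `x`, by that of a fixed
event, whose measurability in `x` is immediate. -/
theorem cert_add_noCert (δ : DisclosureRule) (x : unitInterval) :
    (δ.kernel x).real {Sum.inl x} + (δ.kernel x).real {noCert} = 1 := by
  rw [← measureReal_union (by simp) measurableSet_noCert, singleton_union, Measure.real,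
    δ.verifiable x, ENNReal.toReal_one]

theorem measurable_noCert (δ : DisclosureRule) :
    Measurable fun x : unitInterval => (δ.kernel x).real {noCert} :=
  (Kernel.measurable_coe δ.kernel measurableSet_noCert).ennreal_toReal

/-- The rule that certifies the posterior means from `k` on. -/
def threshold (k : ℝ) : DisclosureRule where
  kernel := Kernel.deterministic (fun x : unitInterval => if (x : ℝ) < k then noCert else Sum.inl x)
    (Measurable.ite (measurableSet_lt (by fun_prop) (by fun_prop)) measurable_const measurable_inl)
  markov := inferInstance
  verifiable x := by
    rw [Kernel.deterministic_apply]
    refine Measure.dirac_apply_of_mem ?_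
    split_ifs <;> simp

theorem threshold_noCert (k : ℝ) (x : unitInterval) :
    (threshold k).kernel x {noCert} = {y : unitInterval | (y : ℝ) < k}.indicator 1 x := by
  rw [threshold, Kernel.deterministic_apply, Measure.dirac_apply' _ measurableSet_noCert]
  by_cases h : (x : ℝ) < k <;> simp [indicator, h]

end DisclosureRule

/-! ### The sender's best reply and existence of equilibrium -/

namespace DisclosureModel

variable {M : DisclosureModel}

theorem integrable_disclosure (M : DisclosureModel) (δ : DisclosureRule) (e : ℝ)
    (G : Measure unitInterval) [IsFiniteMeasure G] :
    Integrable (fun x : unitInterval => (1 - (δ.kernel x).real {noCert}) * ((x : ℝ) - M.γ)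
      + (δ.kernel x).real {noCert} * e) G := by
  have hq := δ.measurable_noCert
  refine Integrable.add ?_ ?_
  · refine (Continuous.integrable_unitInterval (f := fun x : unitInterval => (x : ℝ) - M.γ)
      (by fun_prop) _).bdd_mul (c := 1) (hq.const_sub 1).aestronglyMeasurable (ae_of_all _ fun x => ?_)
    rw [Real.norm_eq_abs, abs_of_nonneg (sub_nonneg.2 measureReal_le_one)]
    linarith [measureReal_nonneg (μ := δ.kernel x) (s := {noCert})]
  · refine (integrable_const e).bdd_mul (c := 1) hq.aestronglyMeasurable (ae_of_all _ fun x => ?_)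
    rw [Real.norm_eq_abs, abs_of_nonneg measureReal_nonneg]
    exact measureReal_le_one

theorem senderPayoff_eq (a : Message → unitInterval) (ha : ∀ x, a (Sum.inl x) = x) (π : M.Signal)
    (δ : DisclosureRule) :
    M.senderPayoff a π δ = ∫ x, ((1 - (δ.kernel x).real {noCert}) * ((x : ℝ) - M.γ)
      + (δ.kernel x).real {noCert} * (a noCert : ℝ) - M.κ * M.c x) ∂π.posteriorLaw := by
  rw [senderPayoff, infoCost, integral_sub (M.integrable_disclosure δ _ _)
    ((M.integrable_c _).const_mul _), integral_const_mul]
  congr 1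
  refine integral_congr_ae (ae_of_all _ fun x => ?_)
  simp only
  rw [ha, ← δ.cert_add_noCert x]
  ring

/-- At each realization a disclosure rule averages `a noCert` and `x - γ`, hence yields at most
their maximum. The threshold rule below attains the bound. -/
theorem senderPayoff_le (a : Message → unitInterval) (ha : ∀ x, a (Sum.inl x) = x) (π : M.Signal)
    (δ : DisclosureRule) :
    M.senderPayoff a π δ ≤ ∫ x, M.V (a noCert) x ∂π.posteriorLaw := by
  rw [senderPayoff_eq a ha]
  refine integral_mono ((M.integrable_disclosure δ _ _).sub ((M.integrable_c _).const_mul _))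
    (M.integrable_V (a noCert) π.posteriorLaw) fun x => ?_
  simp only [V_eq]
  have h0 : 0 ≤ (δ.kernel x).real {noCert} := measureReal_nonneg
  have h1 : (δ.kernel x).real {noCert} ≤ 1 := measureReal_le_one
  have h2 := mul_le_mul_of_nonneg_left (le_max_right (a noCert : ℝ) (x - M.γ)) (sub_nonneg.2 h1)
  have h3 := mul_le_mul_of_nonneg_left (le_max_left (a noCert : ℝ) (x - M.γ)) h0
  linarith

theorem senderPayoff_threshold (a : Message → unitInterval) (ha : ∀ x, a (Sum.inl x) = x)
    (π : M.Signal) :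
    M.senderPayoff a π (DisclosureRule.threshold (a noCert + M.γ))
      = ∫ x, M.V (a noCert) x ∂π.posteriorLaw := by
  rw [senderPayoff_eq a ha]
  refine integral_congr_ae (ae_of_all _ fun x => ?_)
  simp only [Measure.real, DisclosureRule.threshold_noCert, V, indicator, mem_ofPred_eq]
  split_ifs <;> simp

theorem threshold_comp_noCert (κ : Kernel unitInterval unitInterval) (k : ℝ) (θ : unitInterval) :
    ((DisclosureRule.threshold k).kernel ∘ₖ κ) θ {noCert} = κ θ {y : unitInterval | (y : ℝ) < k} := by
  rw [Kernel.comp_apply' _ _ _ measurableSet_noCert]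
  simp_rw [DisclosureRule.threshold_noCert]
  exact lintegral_indicator_one (measurableSet_lt (by fun_prop) (by fun_prop))

theorem outcome_threshold_noCertEvent (π : M.Signal) (k : ℝ) :
    M.outcome π (DisclosureRule.threshold k) noCertEvent
      = π.posteriorLaw {y : unitInterval | (y : ℝ) < k} := by
  have hS : MeasurableSet {y : unitInterval | (y : ℝ) < k} :=
    measurableSet_lt (by fun_prop) (by fun_prop)
  rw [outcome, noCertEvent, Measure.compProd_apply (measurable_snd measurableSet_noCert),
    Signal.posteriorLaw, Measure.bind_apply hS (Kernel.aemeasurable _)]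
  refine lintegral_congr fun θ => ?_
  rw [← threshold_comp_noCert π.kernel k θ]
  rfl

theorem setIntegral_outcome_threshold (π : M.Signal) (k : ℝ) :
    ∫ z in noCertEvent, (z.1 : ℝ) ∂M.outcome π (DisclosureRule.threshold k)
      = ∫ y in {y : unitInterval | (y : ℝ) < k}, (y : ℝ) ∂π.posteriorLaw := by
  have hS : MeasurableSet {y : unitInterval | (y : ℝ) < k} :=
    measurableSet_lt (by fun_prop) (by fun_prop)
  have hb : ∀ y : unitInterval, ‖(y : ℝ)‖ ≤ 1 := fun y => by
    rw [Real.norm_eq_abs, abs_of_nonneg y.2.1]; exact y.2.2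
  rw [← π.setIntegral_state hS, outcome, noCertEvent, ← univ_prod, ← univ_prod,
    Measure.setIntegral_compProd MeasurableSet.univ measurableSet_noCert,
    Measure.setIntegral_compProd MeasurableSet.univ hS]
  · simp only [setIntegral_const, Measure.real, threshold_comp_noCert]
  · exact (Integrable.of_bound (Measurable.aestronglyMeasurable (by fun_prop)) 1
      (ae_of_all _ fun z => hb _)).integrableOn
  · exact (Integrable.of_bound (Measurable.aestronglyMeasurable (by fun_prop)) 1
      (ae_of_all _ fun z => hb _)).integrableOn

/-- The assessment in which the sender chooses `π` and certifies from `e + γ` on, and the receiver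
answers non-certification with `e`. -/
def thresholdAssessment (π : M.Signal) (e : unitInterval) : M.Assessment where
  signal := π
  disclose _ := DisclosureRule.threshold (e + M.γ)
  action m _ := Sum.elim id (fun _ => e) m
  belief m _ := Sum.elim id (fun _ => e) m

theorem path_thresholdAssessment (π : M.Signal) (e : unitInterval) :
    (thresholdAssessment π e).path noCertEvent
      = π.posteriorLaw {y : unitInterval | (y : ℝ) < e + M.γ} :=
  outcome_threshold_noCertEvent π _

/-- Almost every uncertified realization equals `e`, so the belief `e` is correct whenever it is on
path. A deviation yields at most `∫ V_e` at some contraction of the prior, which the chosen signal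
maximizes. -/
theorem isCovertEquilibrium_threshold (π : M.Signal) (e : unitInterval)
    (hsol : M.IsSolution e π.posteriorLaw)
    (he : ∀ᵐ y : unitInterval ∂π.posteriorLaw, (y : ℝ) < e + M.γ → y = e) :
    IsCovertEquilibrium (thresholdAssessment π e) where
  belief_cert _ _ := rfl
  belief_noCert := by
    refine ⟨e, fun _ => rfl, fun h => ?_⟩
    have hE : MeasurableSet noCertEvent := measurable_snd measurableSet_noCert
    have hS : MeasurableSet {y : unitInterval | (y : ℝ) < e + M.γ} :=
      measurableSet_lt (by fun_prop) (by fun_prop)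
    have h1 : ∫ z in noCertEvent, (z.1 : ℝ) ∂(thresholdAssessment π e).path
        = (π.posteriorLaw {y : unitInterval | (y : ℝ) < e + M.γ}).toReal * e := by
      refine (setIntegral_outcome_threshold π _).trans ?_
      rw [setIntegral_congr_ae (g := fun _ => (e : ℝ)) hS (he.mono fun y hy hyS => by rw [hy hyS]),
        setIntegral_const, smul_eq_mul, Measure.real]
    rw [ProbabilityTheory.cond, integral_smul_measure, h1, path_thresholdAssessment, smul_eq_mul,
      ENNReal.toReal_inv, inv_mul_cancel_left₀]
    rw [path_thresholdAssessment] at h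
    exact (ENNReal.toReal_pos h (measure_ne_top _ _)).ne'
  action_eq _ _ := rfl
  optimal π' d' := by
    have h1 := senderPayoff_le (fun m => (thresholdAssessment π e).action m π') (fun _ => rfl) π' (d' π')
    have h2 := senderPayoff_threshold (fun m => (thresholdAssessment π e).action m π) (fun _ => rfl) π
    exact h1.trans ((hsol.2 _ π'.isMPC).trans h2.ge)

theorem mean_mem : M.mean ∈ Ioo (0 : ℝ) 1 := by
  have hI := M.isMPC_self.ae_mem_Ioo
  have hi := continuous_subtype_val.integrable_unitInterval M.F
  have hpos : ∀ g : unitInterval → ℝ, Integrable g M.F → (∀ᵐ y ∂M.F, 0 < g y) → 0 < ∫ y, g y ∂M.F := by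
    intro g hg h
    rw [integral_pos_iff_support_of_nonneg_ae (h.mono fun y hy => hy.le) hg]
    have : M.F (Function.support g) = M.F univ :=
      measure_congr (Filter.eventuallyEq_univ.2 (h.mono fun y hy => hy.ne'))
    rw [this, measure_univ]
    exact one_pos
  refine ⟨hpos _ hi (hI.mono fun y hy => hy.1), ?_⟩
  have h := hpos (fun y => 1 - (y : ℝ)) ((integrable_const _).sub hi)
    (hI.mono fun y hy => sub_pos.2 hy.2)
  rw [integral_sub (integrable_const _) hi] at h
  change ∫ y : unitInterval, (y : ℝ) ∂M.F < 1
  simpa using h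

theorem exists_covertEquilibrium (M : DisclosureModel) :
    ∃ σ : M.Assessment, IsCovertEquilibrium σ := by
  have hm := M.mean_mem
  have main : ∀ α ∈ Icc (0 : ℝ) M.mean, ∀ t, (α, t) ∈ M.optimal →
      ((0 : ℝ) < t.2.2 → (t.1 : ℝ) < α + M.γ → (t.1 : ℝ) = α) →
      ∃ σ : M.Assessment, IsCovertEquilibrium σ := by
    rintro α hα ⟨a, b, p⟩ ht h
    obtain ⟨π, hπ⟩ := exists_signal (M.le_of_mem_optimal ht) ht.2.2.2.1
    obtain ⟨-, hbI⟩ := ae_binary_iff.1 ht.2.2.2.1.ae_mem_Ioo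
    refine ⟨_, isCovertEquilibrium_threshold π ⟨α, hα.1, hα.2.trans hm.2.le⟩ ?_ ?_⟩
    · rw [hπ]; exact ht.2.2.2
    · rw [hπ, ae_binary_iff]
      refine ⟨fun hp hak => Subtype.ext (h hp hak), fun hp hbk => ?_⟩
      have hb := ht.2.2.1
      rcases min_le_iff.1 hb with h' | h'
      · exact absurd hbk (not_lt.2 h')
      · exact absurd (hbI hp).2 (not_lt.2 h')
  -- If some optimum puts no mass strictly below its threshold, non-certification is off path and
  -- the belief `α` is free. Otherwise the low point always has mass strictly below the threshold.
  by_cases hfull : ∃ α ∈ Icc (0 : ℝ) M.mean, ∃ t, (α, t) ∈ M.optimal ∧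
      ((0 : ℝ) < t.2.2 → ¬ (t.1 : ℝ) < α + M.γ)
  · obtain ⟨α, hα, t, ht, h⟩ := hfull
    exact main α hα t ht fun hp hk => absurd hk (h hp)
  push Not at hfull
  have hex : ∀ α : ℝ, ∃ t, 0 ≤ α → (α, t) ∈ M.optimal := by
    intro α
    by_cases hα : 0 ≤ α
    · obtain ⟨t, ht⟩ := M.exists_optimal hα
      exact ⟨t, fun _ => ht⟩
    · exact ⟨(0, 0, 0), fun h => absurd h hα⟩
  choose t ht using hex
  have hcont : ContinuousOn (fun α => ((t α).1 : ℝ)) (Icc 0 M.mean) := by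
    refine M.continuousOn_of_optimal (fun α hα => hα.1) fun α hα t' ht' => ?_
    have heq := ht'.2.2.2.eq hα.1 (ht α hα.1).2.2.2
    simp only at heq
    obtain ⟨hp, hk⟩ := hfull α hα t' ht'
    -- The low point of any optimal triple carries mass, so it is one of the two chosen points. It
    -- cannot be the upper one, being below both the threshold and 1.
    have hae : ∀ᵐ y ∂binary (t α).1 (t α).2.1 (t α).2.2, y = (t α).1 ∨ y = (t α).2.1 := by
      rw [ae_binary_iff]; simp
    rw [← heq, ae_binary_iff] at hae
    rcases hae.1 hp with h | h
    · rw [h]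
    · have hb := (ht α hα.1).2.2.1
      simp only [← h] at hb
      rcases min_le_iff.1 hb with h' | h'
      · exact absurd hk (not_lt.2 h')
      · exact absurd ((ae_binary_iff.1 ht'.2.2.2.1.ae_mem_Ioo).1 hp).2 (not_lt.2 h')
  have hmean : ((t M.mean).1 : ℝ) ≤ M.mean := by
    have h := ht M.mean hm.1.le
    have h1 : _ = M.mean := (isMPC_binary_iff.1 h.2.2.2.1).2
    have h2 := mul_le_mul_of_nonneg_left (M.le_of_mem_optimal h) (sub_nonneg.2 (t M.mean).2.2.2.2)
    simp only at h1 h2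
    linarith
  obtain ⟨α, hα, h⟩ : (0 : ℝ) ∈ (fun α => α - ((t α).1 : ℝ)) '' Icc 0 M.mean :=
    intermediate_value_Icc hm.1.le (continuousOn_id.sub hcont)
      ⟨by simpa using (t 0).1.2.1, by simpa using hmean⟩
  exact main α hα (t α) (ht α hα.1) fun _ _ => (sub_eq_zero.1 h).symm

end DisclosureModel

/-! ### Two equilibria in a uniform-quadratic model -/

theorem cdfOn_volume {s : ℝ} (hs : s ∈ Icc (0 : ℝ) 1) :
    cdfOn (volume : Measure unitInterval) s = s := by
  have h : (volume : Measure unitInterval) {x : unitInterval | (x : ℝ) ≤ s} = ENNReal.ofReal s := by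
    have : Subtype.val '' {x : unitInterval | (x : ℝ) ≤ s} = Icc 0 s := by
      ext x
      constructor
      · rintro ⟨y, hy, rfl⟩
        exact ⟨y.2.1, hy⟩
      · exact fun hx => ⟨⟨x, hx.1, hx.2.trans hs.2⟩, hx.2, rfl⟩
    rw [unitInterval.volume_apply, this, Real.volume_Icc, sub_zero]
  rw [cdfOn, Measure.real, h, ENNReal.toReal_ofReal hs.1]

theorem integral_max_sub_volume {x : ℝ} (hx : x ∈ Icc (0 : ℝ) 1) :
    ∫ y : unitInterval, max (x - (y : ℝ)) 0 = x ^ 2 / 2 := by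
  rw [← integral_cdfOn volume hx.1, intervalIntegral.integral_congr (g := fun s => s)]
  · simp
  · intro s hs
    rw [uIcc_of_le hx.1] at hs
    exact cdfOn_volume ⟨hs.1, hs.2.trans hx.2⟩

theorem integral_coe_volume : ∫ y : unitInterval, (y : ℝ) = 1 / 2 := by
  have h := integral_max_one_sub (volume : Measure unitInterval)
  rw [integral_max_sub_volume ⟨zero_le_one, le_rfl⟩] at h
  linarith

namespace DisclosureModel

/-- A duality certificate: all contractions share the prior mean, so an affine majorant of `V α` has
the same integral against each of them. -/
theorem isSolution_of_le_affine (M : DisclosureModel) {α A B : ℝ} {G : Measure unitInterval}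
    (hG : IsMPC M.F G) (hle : ∀ y : unitInterval, M.V α y ≤ A + B * y)
    (h : A + B * M.mean ≤ ∫ y, M.V α y ∂G) : M.IsSolution α G := by
  refine ⟨hG, fun G' hG' => le_trans ?_ h⟩
  obtain ⟨hp, -, hm⟩ := isMPC_iff.1 hG'
  have hi := continuous_subtype_val.integrable_unitInterval G'
  calc ∫ y, M.V α y ∂G' ≤ ∫ y : unitInterval, (A + B * (y : ℝ)) ∂G' :=
        integral_mono (M.integrable_V α G') ((integrable_const _).add (hi.const_mul _)) hle
    _ = A + B * M.mean := by
        rw [integral_add (integrable_const _) (hi.const_mul _), integral_const_mul, hm]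
        simp [mean]

/-- The model with a uniform prior, a quadratic cost of evidence, and a cost of certification at
which the sender's gain from certifying just covers the cost of learning at many thresholds. -/
def uniformQuadratic : DisclosureModel where
  F := volume
  c x := (x - 1 / 2) ^ 2
  κ := 1
  γ := 1 / 4
  prob_F := inferInstance
  density_F := ⟨fun _ => 1, measurable_const, fun _ _ => one_pos, by simp⟩
  logConcave_F := by
    refine (strictConcaveOn_log_Ioi.subset (fun x hx => hx.1) (convex_Ioo 0 1)).congr fun s hs => ?_
    rw [cdfOn_volume ⟨hs.1.le, hs.2.le⟩]
  differentiable_c := by fun_prop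
  differentiable_deriv_c := by
    have : deriv (fun x : ℝ => (x - 1 / 2) ^ 2) = fun x => 2 * (x - 1 / 2) := by
      ext x
      simp [deriv_fun_pow]
    rw [this]
    fun_prop
  strictConvex_c := by
    refine ⟨convex_Ioo 0 1, fun x _ y _ hxy a b ha hb hab => ?_⟩
    obtain rfl : b = 1 - a := by linarith
    simp only [smul_eq_mul]
    have := mul_pos (mul_pos ha hb) (sq_pos_of_ne_zero (sub_ne_zero.2 hxy))
    nlinarith
  bounded_c := ⟨1, fun x hx => by rw [abs_le]; constructor <;> nlinarith [hx.1, hx.2]⟩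
  c_mean := by rw [integral_coe_volume]; norm_num
  κ_pos := one_pos
  γ_pos := by norm_num

theorem mean_uniformQuadratic : uniformQuadratic.mean = 1 / 2 := integral_coe_volume

theorem V_uniformQuadratic (α x : ℝ) :
    uniformQuadratic.V α x = max α (x - 1 / 4) - (x - 1 / 2) ^ 2 := by
  rw [V_eq]
  simp [uniformQuadratic]

theorem isMPC_uniformQuadratic_iff {a b p : unitInterval} :
    IsMPC uniformQuadratic.F (binary a b p) ↔
      (∀ x ∈ Icc (0 : ℝ) 1, (p : ℝ) * max (x - a) 0 + (1 - p) * max (x - b) 0 ≤ x ^ 2 / 2) ∧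
      (p : ℝ) * a + (1 - p) * b = 1 / 2 := by
  rw [isMPC_binary_iff]
  refine and_congr (forall₂_congr fun x hx => ?_) ?_
  · rw [show uniformQuadratic.F = volume from rfl, integral_max_sub_volume hx]
  · rw [show uniformQuadratic.F = volume from rfl, integral_coe_volume]

theorem exists_covertEquilibrium_uniformQuadratic {a b p : unitInterval} (hab : (a : ℝ) ≤ b)
    (hG : IsMPC uniformQuadratic.F (binary a b p))
    (hsol : uniformQuadratic.IsSolution a (binary a b p)) (hb : (p : ℝ) < 1 → (a : ℝ) + 1 / 4 ≤ b) :
    ∃ σ : uniformQuadratic.Assessment, IsCovertEquilibrium σ ∧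
      σ.path noCertEvent = ENNReal.ofReal p := by
  have hγ : uniformQuadratic.γ = 1 / 4 := rfl
  obtain ⟨π, hπ⟩ := exists_signal hab hG
  refine ⟨_, isCovertEquilibrium_threshold π a (hπ ▸ hsol) ?_, ?_⟩
  · rw [hπ, ae_binary_iff, hγ]
    exact ⟨fun _ _ => rfl, fun hp h => absurd h (not_lt.2 (hb hp))⟩
  · rw [path_thresholdAssessment, hπ, binary_apply, hγ]
    rcases p.2.2.eq_or_lt with h | h
    · simp [h]
    · have := not_lt.2 (hb h)
      rw [indicator_of_notMem (a := b) this]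
      simp

/-- Equal slopes on the two branches of `V_α` force tangency points `1/2` apart, and `γ = 1/4`
centers them at the threshold: they are `α` and `α + 1/2`. The belief `α` is thus self-confirming
for a whole range of `α`, and two values are exhibited. -/
theorem exists_two_covertEquilibria :
    ∃ (M : DisclosureModel) (σ τ : M.Assessment), IsCovertEquilibrium σ ∧ IsCovertEquilibrium τ ∧
      σ.path noCertEvent ≠ τ.path noCertEvent := by
  have key : ∀ (a b p : unitInterval), (a : ℝ) ≤ b →
      IsMPC uniformQuadratic.F (binary a b p) → ∀ A B : ℝ,
      (∀ y : unitInterval, uniformQuadratic.V a y ≤ A + B * y) →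
      A + B / 2 ≤ p * uniformQuadratic.V a a + (1 - p) * uniformQuadratic.V a b →
      ((p : ℝ) < 1 → (a : ℝ) + 1 / 4 ≤ b) →
      ∃ σ : uniformQuadratic.Assessment, IsCovertEquilibrium σ ∧
        σ.path noCertEvent = ENNReal.ofReal p := by
    intro a b p hab hG A B hle h hb
    refine exists_covertEquilibrium_uniformQuadratic hab hG
      (isSolution_of_le_affine _ hG hle ?_) hb
    rw [mean_uniformQuadratic, integral_binary]
    linarith
  -- At `α = 1/2` nothing is learned or certified: `V_α` peaks at the mean with value `1/2`, so a
  -- constant majorizes it.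
  obtain ⟨σ, hσ, hσp⟩ := key ⟨1 / 2, by norm_num, by norm_num⟩ ⟨1 / 2, by norm_num, by norm_num⟩ 1
    le_rfl (isMPC_uniformQuadratic_iff.2 ⟨fun x hx => by
      simp only [Icc.coe_one, one_mul, sub_self, zero_mul, add_zero]
      refine max_le ?_ (by positivity)
      nlinarith [sq_nonneg (x - 1)], by norm_num⟩) (1 / 2) 0
    (fun y => by
      rw [V_uniformQuadratic, sub_le_iff_le_add]
      refine max_le ?_ ?_ <;> nlinarith [sq_nonneg ((y : ℝ) - 1 / 2), sq_nonneg ((y : ℝ) - 1)])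
    (by simp only [V_uniformQuadratic]; norm_num) (by simp)
  -- At `α = 1/4` the distribution is that of learning which half of `[0, 1]` contains the state,
  -- and certification has probability `1/2`. The line `1/16 + y/2` is the common tangent at `1/4`
  -- and `3/4`.
  obtain ⟨τ, hτ, hτp⟩ := key ⟨1 / 4, by norm_num, by norm_num⟩ ⟨3 / 4, by norm_num, by norm_num⟩
    ⟨1 / 2, by norm_num, by norm_num⟩ (by norm_num) (isMPC_uniformQuadratic_iff.2 ⟨fun x hx => by
      simp only
      rcases max_cases (x - 1 / 4) 0 with ⟨h, _⟩ | ⟨h, _⟩ <;>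
        rcases max_cases (x - 3 / 4) 0 with ⟨h', _⟩ | ⟨h', _⟩ <;> rw [h, h'] <;>
        nlinarith [sq_nonneg (x - 1), sq_nonneg (x - 1 / 2), hx.1], by norm_num⟩) (1 / 16) (1 / 2)
    (fun y => by
      rw [V_uniformQuadratic, sub_le_iff_le_add]
      refine max_le ?_ ?_ <;>
        nlinarith [sq_nonneg ((y : ℝ) - 1 / 4), sq_nonneg ((y : ℝ) - 3 / 4)])
    (by simp only [V_uniformQuadratic]; norm_num) (by norm_num)
  refine ⟨uniformQuadratic, σ, τ, hσ, hτ, ?_⟩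
  rw [hσp, hτp]
  intro h
  rw [ENNReal.ofReal_eq_ofReal_iff (by simp) (by norm_num)] at h
  norm_num at h

end DisclosureModel

end

theorem theorem1 :
    -- for all primitives: the sender's problem, and existence of an equilibrium
    (∀ M : DisclosureModel,
      (∃ G : ℝ → Measure unitInterval,
        (∀ α ∈ Set.Icc (0 : ℝ) M.mean,
          (∀ H : Measure unitInterval, M.IsSolution α H ↔ H = G α) ∧
          (G α).support.encard ≤ 2) ∧
        ContinuousOn (fun α => lowerSupport (G α))
          {α | α ∈ Set.Icc (0 : ℝ) M.mean ∧ (G α).support.encard = 2}) ∧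
      ∃ σ : M.Assessment, DisclosureModel.IsCovertEquilibrium σ) ∧
    -- for some primitives: equilibria with different probabilities of certification
    (∃ (M : DisclosureModel) (σ τ : M.Assessment),
      DisclosureModel.IsCovertEquilibrium σ ∧ DisclosureModel.IsCovertEquilibrium τ ∧
      σ.path DisclosureModel.noCertEvent ≠ τ.path DisclosureModel.noCertEvent) := by
  exact ⟨fun M => ⟨M.exists_unique_solution, M.exists_covertEquilibrium⟩,
    DisclosureModel.exists_two_covertEquilibria⟩
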